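/- Let $M$ be a compact connected Riemann surface with canonical bundle $K$, let $\mathcal C$ be the conformal class of its smooth Riemannian metrics compatible with the complex structure (that is, the metrics $g=\mathrm{Re}\,h$ with $h$ a smooth Hermitian metric; locally $h=e^{2\omega}dz\otimes d\bar z$, $g=e^{2\omega}(dx^2+dy^2)$), and let $S$ be a spin structure: a holomorphic line bundle with a holomorphic isomorphism $S\otimes S\cong K$. For $g\in\mathcal C$, give $S$ the Hermitian metric $|s|_g^2=|s\otimes s|_g$ and let $\mathcal D_g(\psi_+,\psi_-)=2(\partial_g\psi_-,-\bar\partial_g\psi_+)$ be the Dirac operator on smooth sections of $S\oplus\bar S$, where $\bar\partial_g(f s_0)=|s_0|_g^2\,(\partial_{\bar z}f)\,\bar s_0$ for a local holomorphic section $s_0$ of $S$ with $s_0\otimes s_0=dz$, and $\partial_g$ is its complex conjugate. Equip $\mathbb{CP}^1$ with four times the Fubini--Study metric (the round metric of the unit sphere), and for $\Psi\colon M\to\mathbb{CP}^1$ put $$E^{(0,1)}(\Psi)=\int_M|\bar\partial\Psi|_g^2\,dv_g,\qquad |\bar\partial\Psi|_g^2=\frac{4\,|\pi_{F^\perp}\partial_{\bar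 z}F|^2}{e^{2\omega}|F|^2}$$ for any local lift $F$ of $\Psi$ to $\mathbb C^2\setminus\{0\}$ (wherever $\Psi$ is differentiable). (1) Let $g\in\mathcal C$, $\lambda\in\mathbb R\setminus\{0\}$, and let $\psi=(\psi_+,\psi_-)\not\equiv0$ be a smooth eigenspinor, $\mathcal D_g\psi=\lambda\psi$. Then the map $[\psi_+:\bar\psi_-]$, defined where $\psi\neq0$, has a unique continuous extension $\Psi\colon M\to\mathbb{CP}^1$, and $$E^{(0,1)}(\Psi)=\lambda^2\,\mathrm{Area}(M,g),$$ where $E^{(0,1)}(\Psi)$ may be computed with any metric in $\mathcal C$. (2) Let $\Gamma_{\mathcal C,S}$ be the set of all maps $\Psi$ arising as in (1), over all $g\in\mathcal C$, all $\lambda\ne0$ and all eigenspinors $\psi$. Let $\lambda_1(M,g,S)$ be the smallest positive eigenvalue of $\mathcal D_g$ and $\Lambda_1(M,\mathcal C,S)=\inf_{g\in\mathcal C}\lambda_1(M,g,S)\,\mathrm{Area}(M,g)^{1/2}$. Then $$\Lambda_1(M,\mathcal C,S)^2=\inf_{\Psi\in\Gamma_{\mathcal C,S}}E^{(0,1)}(\Psi),$$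 where again $E^{(0,1)}$ may be computed with any metric in $\mathcal C$. -/

import Mathlib

open Bundle Set MeasureTheory
open scoped Manifold ContDiff Topology ENNReal TensorProduct LinearAlgebra.Projectivization

noncomputable section

namespace DiracSurface

/-! ### Conjugate vector spaces -/

/-- The complex conjugate `V̄` of a complex vector space `V`: the same additive group, on which
`c : ℂ` acts as `conj c` acts on `V`. -/
def ConjSpace (V : Type*) : Type _ := V

instance (V : Type*) [AddCommGroup V] : AddCommGroup (ConjSpace V) :=
  inferInstanceAs (AddCommGroup V)

instance (V : Type*) [AddCommGroup V] [Module ℂ V] : Module ℂ (ConjSpace V) :=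
  Module.compHom V (starRingEnd ℂ)

/-- The conjugation `V → V̄`, `v ↦ v̄`. -/
def bar {V : Type*} (v : V) : ConjSpace V := v

/-- The conjugation `V̄ → V`, `w ↦ w̄`. -/
def unbar {V : Type*} (w : ConjSpace V) : V := w

/-! ### Riemann surfaces: coordinate fields, the `∂̄`-operator, Hermitian metrics, area -/

section Surface

variable {M : Type*} [TopologicalSpace M] [ChartedSpace ℂ M]

/-- The coordinate vector field `∂_z` of the holomorphic coordinate `z = chartAt ℂ x₀`, at the
point of `M` with coordinate `z`. -/
def coordVec (x₀ : M) (z : ℂ) : TangentSpace 𝓘(ℂ, ℂ) ((chartAt ℂ x₀).symm z) :=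
  mfderiv 𝓘(ℂ, ℂ) 𝓘(ℂ, ℂ) (chartAt ℂ x₀).symm z (1 : ℂ)

/-- The vector `∂_z` at `x`, for the preferred coordinate `z = chartAt ℂ x` at `x`. The tangent
space at `x` is identified with `ℂ` through this coordinate. -/
def baseVec (x : M) : TangentSpace 𝓘(ℂ, ℂ) x := (1 : ℂ)

/-- The real differential of a vector valued function on a Riemann surface. -/
def realDiff {E : Type*} [NormedAddCommGroup E] [NormedSpace ℂ E] (F : M → E) (x : M)
    (v : TangentSpace 𝓘(ℂ, ℂ) x) : E :=
  mfderiv 𝓘(ℝ, ℂ) 𝓘(ℝ, E) F x v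

/-- `∂̄F`, the conjugate-linear part of the differential of `F`: `∂̄F(v) = (dF(v) + i dF(iv)) / 2`.
On `v = ∂_z` it is the Wirtinger derivative `∂F/∂z̄`. -/
def dbar {E : Type*} [NormedAddCommGroup E] [NormedSpace ℂ E] (F : M → E) (x : M)
    (v : TangentSpace 𝓘(ℂ, ℂ) x) : E :=
  (1 / 2 : ℂ) • (realDiff F x v + Complex.I • realDiff F x (Complex.I • v))

variable (M) in
/-- A smooth Hermitian metric `h` on a Riemann surface, a positive section of `K ⊗ K̄`.
The metrics `g = Re h` are exactly the Riemannian metrics in the conformal class of the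
complex structure, so this type plays the role of the conformal class. -/
structure HermitianMetric where
  /-- The sesquilinear form on each tangent space. -/
  form : ∀ x : M, TangentSpace 𝓘(ℂ, ℂ) x →ₗ[ℂ] TangentSpace 𝓘(ℂ, ℂ) x →ₗ⋆[ℂ] ℂ
  im_eq_zero : ∀ x v, (form x v v).im = 0
  pos : ∀ x v, v ≠ 0 → 0 < (form x v v).re
  smooth : ∀ x₀ : M, ContDiffOn ℝ ∞
    (fun z : ℂ => (form ((chartAt ℂ x₀).symm z) (coordVec x₀ z) (coordVec x₀ z)).re)
    (chartAt ℂ x₀).target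

namespace HermitianMetric

/-- `|v|²_g = h(v, v̄)` for a tangent vector `v`. -/
def normSq (g : HermitianMetric M) (x : M) (v : TangentSpace 𝓘(ℂ, ℂ) x) : ℝ :=
  (g.form x v v).re

/-- The conformal factor `e^{2ω}` in `g = e^{2ω} (dx² + dy²)`, in the coordinate `chartAt ℂ x₀`. -/
def factor (g : HermitianMetric M) (x₀ : M) (z : ℂ) : ℝ :=
  g.normSq ((chartAt ℂ x₀).symm z) (coordVec x₀ z)

/-- The norm of a covector `α ∈ K_x`: `|α|_g = |α(v)| / |v|_g` for any `v ≠ 0`. -/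
def covectorNorm (g : HermitianMetric M) (x : M) (α : TangentSpace 𝓘(ℂ, ℂ) x →L[ℂ] ℂ) : ℝ :=
  ‖α (baseVec x)‖ / Real.sqrt (g.normSq x (baseVec x))

/-- The area measure `e^{2ω} dx dy` on the domain of the coordinate `chartAt ℂ x₀`, extended
by zero. -/
def chartArea [MeasurableSpace M] (g : HermitianMetric M) (x₀ : M) : Measure M :=
  ((volume.restrict (chartAt ℂ x₀).target).withDensity
    (fun z => ENNReal.ofReal (g.factor x₀ z))).map (chartAt ℂ x₀).symm

/-- The area measure `dv_g`. The local area measures are the restrictions of `dv_g` to the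
coordinate domains, so `dv_g` is their least upper bound. -/
def areaMeasure [MeasurableSpace M] (g : HermitianMetric M) : Measure M :=
  ⨆ x₀ : M, g.chartArea x₀

/-- The total area of the surface. -/
def area [MeasurableSpace M] (g : HermitianMetric M) : ℝ≥0∞ := g.areaMeasure univ

end HermitianMetric

end Surface

/-! ### Maps to the complex projective line -/

/-- The complex projective line. -/
abbrev CP1 : Type := ℙ ℂ (EuclideanSpace ℂ (Fin 2))

/-- The quotient topology on the complex projective line. -/
instance : TopologicalSpace CP1 :=
  inferInstanceAs (TopologicalSpace
    (Quotient (projectivizationSetoid ℂ (EuclideanSpace ℂ (Fin 2)))))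

/-- The affine chart of the projective line centred at `p = [v]`, with `v = p.rep`: it sends the
line `q` to the `w ∈ v^⊥` such that `v + w ∈ q`. It is holomorphic, and its differential at `p`
is the identification `T_p CP¹ ≅ Hom(L_p, L_p^⊥)`, evaluated at `v ∈ L_p`. -/
def affineChart (p q : CP1) : EuclideanSpace ℂ (Fin 2) :=
  (inner ℂ p.rep p.rep / inner ℂ p.rep q.rep : ℂ) • q.rep - p.rep

section Energy

variable {M : Type*} [TopologicalSpace M] [ChartedSpace ℂ M]

/-- `∂̄Ψ` at `x`: the `(1,0)`-component of the differential of `Ψ` on vectors of type `(0,1)`,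
where `v` stands for the `(0,1)`-vector `(v + i J v) / 2` (so `∂_z` stands for `∂_z̄`).
Tangent vectors of type `(1,0)` at `p = Ψ x` are elements of `Hom(L_p, L_p^⊥)`, recorded by
their value at `p.rep`. -/
def dbarMap (Ψ : M → CP1) (x : M) (v : TangentSpace 𝓘(ℂ, ℂ) x) : EuclideanSpace ℂ (Fin 2) :=
  dbar (fun y => affineChart (Ψ x) (Ψ y)) x v

/-- `|∂̄Ψ|²` at `x`, for `g` on the surface and four times the Fubini-Study metric on the
projective line, that is, the metric of the unit sphere. A homomorphism `A : L_p → L_p^⊥` has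
Fubini-Study norm `|A l| / |l|`. -/
def dbarNormSq (g : HermitianMetric M) (Ψ : M → CP1) (x : M) : ℝ :=
  4 * ‖dbarMap Ψ x (baseVec x)‖ ^ 2 / (‖(Ψ x).rep‖ ^ 2 * g.normSq x (baseVec x))

/-- The energy `E^{(0,1)}(Ψ) = ∫ |∂̄Ψ|² dv_g`. -/
def energy01 [MeasurableSpace M] (g : HermitianMetric M) (Ψ : M → CP1) : ℝ≥0∞ :=
  ∫⁻ x, ENNReal.ofReal (dbarNormSq g Ψ x) ∂g.areaMeasure

end Energy

/-! ### Spin structures, spinors and the Dirac operator -/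

section Spin

variable {M : Type*} [TopologicalSpace M] [ChartedSpace ℂ M]
  {S : M → Type*} [∀ x, AddCommGroup (S x)] [∀ x, Module ℂ (S x)] [∀ x, TopologicalSpace (S x)]
  [TopologicalSpace (TotalSpace ℂ S)] [FiberBundle ℂ S]

/-- Holomorphic sections of the line bundle `S` over a set `U`. -/
def IsHolomorphicOn (s : ∀ x, S x) (U : Set M) : Prop :=
  ContMDiffOn 𝓘(ℂ, ℂ) (𝓘(ℂ, ℂ).prod 𝓘(ℂ, ℂ)) ω (fun x => TotalSpace.mk' ℂ x (s x)) U

/-- Smooth (`C^∞` in the real sense) sections of the line bundle `S`. -/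
def IsSmoothSection (s : ∀ x, S x) : Prop :=
  ContMDiff 𝓘(ℝ, ℂ) (𝓘(ℝ, ℂ).prod 𝓘(ℝ, ℂ)) ∞ (fun x => TotalSpace.mk' ℂ x (s x))

variable (S) in
/-- A spin structure with underlying holomorphic line bundle `S`: a holomorphic isomorphism
`S ⊗ S ≅ K`, where the fibre of `K` at `x` is the complex dual of the tangent space. -/
structure SpinStructure where
  iso : ∀ x, S x ⊗[ℂ] S x ≃ₗ[ℂ] (TangentSpace 𝓘(ℂ, ℂ) x →L[ℂ] ℂ)
  /-- In a holomorphic coordinate `z`, the product of two local holomorphic sections is `f dz`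
  with `f` holomorphic. -/
  holomorphic : ∀ U : Set M, IsOpen U → ∀ s t : ∀ x, S x,
    IsHolomorphicOn s U → IsHolomorphicOn t U → ∀ x₀ : M,
      DifferentiableOn ℂ
        (fun z : ℂ => iso ((chartAt ℂ x₀).symm z)
          (s ((chartAt ℂ x₀).symm z) ⊗ₜ t ((chartAt ℂ x₀).symm z)) (coordVec x₀ z))
        ((chartAt ℂ x₀).target ∩ (chartAt ℂ x₀).symm ⁻¹' U)

/-- The square `s ⊗ s ∈ K_x` of `s ∈ S_x`. -/
def SpinStructure.sq (σ : SpinStructure S) (x : M) (s : S x) :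
    TangentSpace 𝓘(ℂ, ℂ) x →L[ℂ] ℂ :=
  σ.iso x (s ⊗ₜ s)

/-- `|s|²` for the Hermitian metric on `S` induced by `g`: `|s|² = |s ⊗ s|`. -/
def SpinStructure.normSq (σ : SpinStructure S) (g : HermitianMetric M) (x : M) (s : S x) : ℝ :=
  g.covectorNorm x (σ.sq x s)

variable (S) in
/-- The local holomorphic frame of `S` given by the preferred local trivialization at `x`,
evaluated at `x`. -/
def frameVec (x : M) : S x := (trivializationAt ℂ S x).symm x 1

/-- The coefficient of a section of `S` with respect to the local holomorphic frame given by the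
preferred local trivialization at `x`. -/
def coeff (s : ∀ x, S x) (x y : M) : ℂ := (trivializationAt ℂ S x ⟨y, s y⟩).2

/-- `∂̄_g : Γ(S) → Γ(S̄)`: the operator `∂̄ : Γ(S) → Γ(S ⊗ K̄)`, `∂̄(f t) = ∂̄f ⊗ t` for a local
holomorphic frame `t`, followed by `S ⊗ K̄ ≅ S ⊗ S̄ ⊗ S̄ → S̄`, the last map being contraction
with the Hermitian metric. Since `∂̄f = (∂̄f(v) / conj ((t ⊗ t)(v))) conj (t ⊗ t)` for every
`v ≠ 0`, this gives `∂̄_g(f t) = |t|² (∂̄f(v) / conj ((t ⊗ t)(v))) t̄`, which depends neither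
on `t` nor on `v`. -/
def dbarOp (σ : SpinStructure S) (g : HermitianMetric M) (s : ∀ x, S x) :
    ∀ x, ConjSpace (S x) := fun x =>
  ((σ.normSq g x (frameVec S x) : ℂ) *
    (dbar (coeff s x) x (baseVec x) /
      (starRingEnd ℂ) (σ.sq x (frameVec S x) (baseVec x)))) • bar (frameVec S x)

/-- `∂_g : Γ(S̄) → Γ(S)`, the conjugate of `∂̄_g`. -/
def delOp (σ : SpinStructure S) (g : HermitianMetric M) (s : ∀ x, ConjSpace (S x)) :
    ∀ x, S x := fun x =>
  unbar (dbarOp σ g (fun y => unbar (s y)) x)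

variable (S) in
/-- Spinor fields `ψ = (ψ₊, ψ₋)`: sections of `S ⊕ S̄`. -/
abbrev SpinorField : Type _ := (∀ x : M, S x) × (∀ x : M, ConjSpace (S x))

/-- Smoothness of a spinor field. -/
def IsSmoothSpinor (ψ : SpinorField S) : Prop :=
  IsSmoothSection ψ.1 ∧ IsSmoothSection (fun x => unbar (ψ.2 x))

/-- The Dirac operator `(ψ₊, ψ₋) ↦ 2 (∂_g ψ₋, -∂̄_g ψ₊)`. -/
def diracOp (σ : SpinStructure S) (g : HermitianMetric M) (ψ : SpinorField S) : SpinorField S :=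
  (2 : ℂ) • (delOp σ g ψ.2, -dbarOp σ g ψ.1)

/-- `ψ` is an eigenspinor of the Dirac operator with eigenvalue `lam`. -/
def IsEigenspinor (σ : SpinStructure S) (g : HermitianMetric M) (lam : ℝ)
    (ψ : SpinorField S) : Prop :=
  IsSmoothSpinor ψ ∧ ψ ≠ 0 ∧ diracOp σ g ψ = (lam : ℂ) • ψ

/-- `Ψ` is the map `[ψ₊ : ψ̄₋]` defined by the spinor field `ψ`: it is continuous on the whole
surface and, wherever `ψ ≠ 0`, it is the point with homogeneous coordinates
`ψ₊ : ψ̄₋`, these being read with respect to any nonzero vector `s` of the fibre of `S`. -/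
def IsSpinorMap (ψ : SpinorField S) (Ψ : M → CP1) : Prop :=
  Continuous Ψ ∧ ∀ (x : M) (s : S x) (a b : ℂ) (hab : !₂[a, b] ≠ 0), s ≠ 0 →
    ψ.1 x = a • s → unbar (ψ.2 x) = b • s → Ψ x = Projectivization.mk ℂ !₂[a, b] hab

/-- The set `Γ_{C,S}` of all maps `[ψ₊ : ψ̄₋]` given by eigenspinors with nonzero eigenvalue, for
some metric in the conformal class. -/
def eigenspinorMaps (σ : SpinStructure S) : Set (M → CP1) :=
  {Ψ | ∃ (g : HermitianMetric M) (lam : ℝ) (ψ : SpinorField S),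
    lam ≠ 0 ∧ IsEigenspinor σ g lam ψ ∧ IsSpinorMap ψ Ψ}

/-- `λ₁(M, g, S)`, the smallest positive Dirac eigenvalue, as the infimum in `[0, ∞]` of the set of
positive eigenvalues (the spectrum is discrete, so the infimum is attained). -/
def lambdaOne (σ : SpinStructure S) (g : HermitianMetric M) : ℝ≥0∞ :=
  ⨅ lam ∈ {lam : ℝ | 0 < lam ∧ ∃ ψ : SpinorField S, IsEigenspinor σ g lam ψ}, ENNReal.ofReal lam

/-- `Λ₁(M, C, S) = inf_{g ∈ C} λ₁(M, g, S) Area(M, g)^{1/2}`. -/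
def LambdaOne [MeasurableSpace M] (σ : SpinStructure S) : ℝ≥0∞ :=
  ⨅ g : HermitianMetric M, lambdaOne σ g * g.area ^ (1 / 2 : ℝ)

end Spin

end DiracSurface

end

/-! In a holomorphic coordinate and frame `s` of `S`, write `ψ₊ = f s`, `ψ̄₋ = h s` and `F = (f,
h)`. The eigenspinor equation becomes `∂̄F = A · J F`, where `J(a, b) = (-b̄, ā)` is the
quaternionic structure of `ℂ²` and `|A|² = λ² e^{2ω} / 4` (`IsEigenspinor.wbar_spinorPair`). Since
`J F` is Hermitian orthogonal to `F` and has the same length, the projection to `F^⊥` loses nothing.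
So for any conformal metric `g'`, off the zeros of `ψ`, `|∂̄Ψ|²_{g'} = 4 |A|² / e^{2ω'} = λ² g / g'`
(`IsEigenspinor.dbarNormSq_eq`). As `dv_g = (g / g') dv_{g'}`
(`HermitianMetric.areaMeasure_eq_withDensity`), integration gives the energy identity, provided the
zeros are negligible.

The analysis lies in the zeros of `F`. The equation gives `|∂̄F| ≤ C |F|`, so a zero of infinite
order forces `F = 0` nearby: this is strong unique continuation, proved with the weights `(z -
z₀)^{-n}` and a sup estimate for `∂̄` (`eventually_eq_zero_of_vanishesTo`). At a zero of finite
order `k`, the term `A · J F` vanishes to the same order, so the degree `k` Taylor polynomial of `F`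
is killed by `∂̄` and equals `(z - z₀)^k c` with `c ≠ 0` (`VanishesTo.exists_leading_term`).
Dividing by `(z - z₀)^k`, which does not change the point of `ℂP¹`, yields a continuous nonvanishing
lift across the zero. By connectedness the first alternative never occurs. Hence zeros are isolated,
finite in number by compactness, and the map has exactly one continuous extension.

For the second claim, the energy identity matches each pair (metric, nonzero eigenvalue) with maps
of energy `λ² Area`. Negative eigenvalues contribute nothing new, because `(ψ₊, -ψ₋)` has eigenvalue
`-λ`. The two infima are then compared directly, without attainment (`LambdaOne_sq_eq`). -/

noncomputable section

namespace DiracSurface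

set_option linter.unusedSectionVars false

/-! ### Order of vanishing of smooth functions -/

section Vanishing

/-- The derivatives of `f` of order less than `k` vanish at `z₀`. -/
def VanishesTo {F : Type*} [NormedAddCommGroup F] [NormedSpace ℝ F] (k : ℕ) (f : ℂ → F) (z₀ : ℂ) : Prop :=
  ∀ j < k, iteratedFDeriv ℝ j f z₀ = 0

theorem VanishesTo.mono {F : Type*} [NormedAddCommGroup F] [NormedSpace ℝ F] {k l : ℕ} {f : ℂ → F}
    {z₀ : ℂ} (h : VanishesTo k f z₀) (hl : l ≤ k) : VanishesTo l f z₀ :=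
  fun j hj => h j (hj.trans_le hl)

theorem vanishesTo_one_iff {F : Type*} [NormedAddCommGroup F] [NormedSpace ℝ F] {f : ℂ → F}
    {z₀ : ℂ} : VanishesTo 1 f z₀ ↔ f z₀ = 0 := by
  constructor
  · intro h
    have := congrArg norm (h 0 zero_lt_one)
    simpa using this
  · intro h j hj
    obtain rfl : j = 0 := by omega
    rw [← norm_eq_zero]
    simpa using h

/-- This recursion through the derivative drives the inductions on the order of vanishing. -/
theorem vanishesTo_succ_iff {F : Type*} [NormedAddCommGroup F] [NormedSpace ℝ F] {k : ℕ}
    {f : ℂ → F} {z₀ : ℂ} :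
    VanishesTo (k + 1) f z₀ ↔ f z₀ = 0 ∧ VanishesTo k (fderiv ℝ f) z₀ := by
  constructor
  · intro h
    refine ⟨vanishesTo_one_iff.1 (h.mono (by omega)), fun j hj => ?_⟩
    rw [← norm_eq_zero, norm_iteratedFDeriv_fderiv, h (j + 1) (by omega), norm_zero]
  · rintro ⟨h0, h⟩ j hj
    cases j with
    | zero => exact (vanishesTo_one_iff.2 h0) 0 zero_lt_one
    | succ j =>
      rw [← norm_eq_zero, ← norm_iteratedFDeriv_fderiv, h j (by omega), norm_zero]

theorem VanishesTo.clm {F G : Type*} [NormedAddCommGroup F] [NormedSpace ℝ F]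
    [NormedAddCommGroup G] [NormedSpace ℝ G] {k : ℕ} {f : ℂ → F} {z₀ : ℂ}
    (h : VanishesTo k f z₀) (hf : ContDiffAt ℝ ∞ f z₀) (L : F →L[ℝ] G) :
    VanishesTo k (fun z => L (f z)) z₀ := by
  intro j hj
  have := L.iteratedFDeriv_comp_left (i := j) hf (by exact_mod_cast le_top)
  change iteratedFDeriv ℝ j (L ∘ f) z₀ = 0
  rw [this, h j hj]
  ext; simp

theorem VanishesTo.add {F : Type*} [NormedAddCommGroup F] [NormedSpace ℝ F] {k : ℕ}
    {f g : ℂ → F} {z₀ : ℂ} (hf : VanishesTo k f z₀) (hg : VanishesTo k g z₀)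
    (cf : ContDiffAt ℝ ∞ f z₀) (cg : ContDiffAt ℝ ∞ g z₀) :
    VanishesTo k (fun z => f z + g z) z₀ := by
  intro j hj
  have := iteratedFDeriv_add_apply (𝕜 := ℝ) (i := j) (x := z₀) (f := f) (g := g)
    (cf.of_le (by exact_mod_cast le_top)) (cg.of_le (by exact_mod_cast le_top))
  change iteratedFDeriv ℝ j (f + g) z₀ = 0
  rw [this, hf j hj, hg j hj, add_zero]

theorem VanishesTo.congr {F : Type*} [NormedAddCommGroup F] [NormedSpace ℝ F] {k : ℕ}
    {f g : ℂ → F} {z₀ : ℂ} (hf : VanishesTo k f z₀) (h : f =ᶠ[𝓝 z₀] g) : VanishesTo k g z₀ := by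
  intro j hj
  rw [← (h.iteratedFDeriv ℝ j).eq_of_nhds, hf j hj]

/-- Induction on `k`: the bound for the derivative holds on the whole ball of radius `‖z - z₀‖`, and
the mean value inequality there gains one power. The target space is generalized because the
derivative has other values. -/
theorem VanishesTo.isBigO {F : Type*} [NormedAddCommGroup F] [NormedSpace ℝ F] {k : ℕ} :
    ∀ {f : ℂ → F} {z₀ : ℂ}, VanishesTo k f z₀ → ContDiffAt ℝ ∞ f z₀ →
      f =O[𝓝 z₀] fun z => ‖z - z₀‖ ^ k := by
  induction k generalizing F with
  | zero =>
    intro f z₀ _ hf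
    simpa using hf.continuousAt.isBigO_one ℝ
  | succ k ih =>
    intro f z₀ h hf
    obtain ⟨h0, h1⟩ := vanishesTo_succ_iff.1 h
    have hf' : ContDiffAt ℝ ∞ (fderiv ℝ f) z₀ := hf.fderiv_right (by exact_mod_cast le_top)
    obtain ⟨C, hC0, hC⟩ := (ih h1 hf').exists_nonneg
    have hd : ∀ᶠ z in 𝓝 z₀, DifferentiableAt ℝ f z :=
      ((hf.of_le (m := 1) (by exact_mod_cast le_top)).eventually (by simp)).mono
        fun z hz => hz.differentiableAt (by simp)
    obtain ⟨r, hr, hball⟩ := Metric.eventually_nhds_iff_ball.1 (hC.bound.and hd)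
    refine Asymptotics.IsBigO.of_bound C ?_
    filter_upwards [Metric.ball_mem_nhds z₀ hr] with z hz
    have hsub : Metric.closedBall z₀ ‖z - z₀‖ ⊆ Metric.ball z₀ r := by
      apply Metric.closedBall_subset_ball
      rwa [← dist_eq_norm]
    have hb : ∀ y ∈ Metric.closedBall z₀ ‖z - z₀‖, ‖fderiv ℝ f y‖ ≤ C * ‖z - z₀‖ ^ k := by
      intro y hy
      have h1 := (hball y (hsub hy)).1
      have h2 : ‖y - z₀‖ ≤ ‖z - z₀‖ := by simpa [dist_eq_norm] using hy
      rw [norm_pow, norm_norm] at h1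
      exact h1.trans (by gcongr)
    have := (convex_closedBall z₀ ‖z - z₀‖).norm_image_sub_le_of_norm_fderiv_le
      (fun y hy => (hball y (hsub hy)).2) hb
      (Metric.mem_closedBall_self (norm_nonneg _)) (y := z) (by simp [dist_eq_norm])
    rw [h0, sub_zero] at this
    rw [norm_pow, norm_norm, pow_succ, ← mul_assoc]
    exact this

/-- Every Leibniz term contains a derivative of `g` of order at most `j < k`, so the product
inherits the vanishing of `g`. -/
theorem VanishesTo.bilinear {F G H : Type*} [NormedAddCommGroup F] [NormedSpace ℝ F]
    [NormedAddCommGroup G] [NormedSpace ℝ G] [NormedAddCommGroup H] [NormedSpace ℝ H]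
    {k : ℕ} {f : ℂ → F} {g : ℂ → G} {z₀ : ℂ} (B : F →L[ℝ] G →L[ℝ] H)
    (hg : VanishesTo k g z₀) (cf : ContDiffAt ℝ ∞ f z₀) (cg : ContDiffAt ℝ ∞ g z₀) :
    VanishesTo k (fun z => B (f z) (g z)) z₀ := by
  intro j hj
  obtain ⟨u, hu, huf⟩ := (cf.of_le (m := j) (by exact_mod_cast le_top)).contDiffOn le_rfl (by simp)
  obtain ⟨v, hv, hvg⟩ := (cg.of_le (m := j) (by exact_mod_cast le_top)).contDiffOn le_rfl (by simp)
  obtain ⟨t, ht, hto, hzt⟩ := mem_nhds_iff.1 (Filter.inter_mem hu hv)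
  have := B.norm_iteratedFDerivWithin_le_of_bilinear
    (huf.mono (ht.trans inter_subset_left)) (hvg.mono (ht.trans inter_subset_right))
    hto.uniqueDiffOn hzt (n := j) le_rfl
  have hz : ∀ i ∈ Finset.range (j + 1), (j.choose i : ℝ) * ‖iteratedFDerivWithin ℝ i f t z₀‖ *
      ‖iteratedFDerivWithin ℝ (j - i) g t z₀‖ = 0 := by
    intro i _
    rw [iteratedFDerivWithin_of_isOpen (j - i) hto hzt, hg (j - i) (by omega)]
    simp
  rw [Finset.sum_eq_zero hz, mul_zero, iteratedFDerivWithin_of_isOpen j hto hzt] at this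
  exact norm_le_zero_iff.1 this

/-! ### Wirtinger derivatives -/

variable {E : Type*} [NormedAddCommGroup E] [NormedSpace ℂ E]

/-- The Wirtinger derivative `∂f/∂z̄`. -/
def wbar (f : ℂ → E) (z : ℂ) : E := (1 / 2 : ℂ) • (fderiv ℝ f z 1 + Complex.I • fderiv ℝ f z Complex.I)

/-- The Wirtinger derivative `∂f/∂z`. -/
def wdel (f : ℂ → E) (z : ℂ) : E := (1 / 2 : ℂ) • (fderiv ℝ f z 1 - Complex.I • fderiv ℝ f z Complex.I)

theorem fderiv_eq_wirtinger (f : ℂ → E) (z v : ℂ) :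
    fderiv ℝ f z v = v • wdel f z + (starRingEnd ℂ) v • wbar f z := by
  have h : fderiv ℝ f z v = v.re • fderiv ℝ f z 1 + v.im • fderiv ℝ f z Complex.I := by
    rw [← map_smul, ← map_smul, ← map_add]
    congr 1
    simp
  have h1 : v.re • fderiv ℝ f z 1 = (v.re : ℂ) • fderiv ℝ f z 1 := (Complex.coe_smul _ _).symm
  have h2 : v.im • fderiv ℝ f z Complex.I = (v.im : ℂ) • fderiv ℝ f z Complex.I :=
    (Complex.coe_smul _ _).symm
  rw [h, h1, h2, wdel, wbar]
  have h3 : v = v.re + v.im * Complex.I := (Complex.re_add_im v).symm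
  have h4 : (starRingEnd ℂ) v = v.re - v.im * Complex.I := by
    apply Complex.ext <;> simp
  rw [h4]
  nth_rewrite 3 [h3]
  match_scalars
  · ring
  · ring_nf
    simp

theorem _root_.HasFDerivAt.wbar_eq {f : ℂ → E} {z : ℂ} {f' : ℂ →L[ℝ] E} (h : HasFDerivAt f f' z) :
    wbar f z = (1 / 2 : ℂ) • (f' 1 + Complex.I • f' Complex.I) := by
  rw [wbar, h.fderiv]

theorem _root_.HasFDerivAt.wdel_eq {f : ℂ → E} {z : ℂ} {f' : ℂ →L[ℝ] E} (h : HasFDerivAt f f' z) :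
    wdel f z = (1 / 2 : ℂ) • (f' 1 - Complex.I • f' Complex.I) := by
  rw [wdel, h.fderiv]

theorem wbar_congr {f g : ℂ → E} {z : ℂ} (h : f =ᶠ[𝓝 z] g) : wbar f z = wbar g z := by
  rw [wbar, wbar, h.fderiv_eq]

theorem _root_.HasDerivAt.hasFDerivAt_real_smul {φ : ℂ → ℂ} {φ' z : ℂ} {f : ℂ → E}
    {f' : ℂ →L[ℝ] E} (hφ : HasDerivAt φ φ' z) (hf : HasFDerivAt f f' z) :
    HasFDerivAt (fun w => φ w • f w)
      (φ z • f' + ((ContinuousLinearMap.toSpanSingleton ℂ φ').restrictScalars ℝ).smulRight (f z)) z := by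
  have := (hφ.hasFDerivAt.restrictScalars ℝ).smul hf
  exact this

theorem wbar_smul {φ : ℂ → ℂ} {f : ℂ → E} {z : ℂ} (hφ : DifferentiableAt ℂ φ z)
    (hf : DifferentiableAt ℝ f z) : wbar (fun w => φ w • f w) z = φ z • wbar f z := by
  rw [(hφ.hasDerivAt.hasFDerivAt_real_smul hf.hasFDerivAt).wbar_eq, wbar]
  simp
  match_scalars
  · ring_nf
  · ring_nf
    simp
  · ring

theorem wbar_pow_smul (z₀ z : ℂ) (k : ℕ) (c : E) : wbar (fun w => (w - z₀) ^ k • c) z = 0 := by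
  rw [wbar_smul (f := fun _ => c) (by fun_prop) (by fun_prop)]
  simp [wbar]

theorem wdel_pow_smul (z₀ z : ℂ) (k : ℕ) (c : E) :
    wdel (fun w => (w - z₀) ^ (k + 1) • c) z = (z - z₀) ^ k • ((k + 1 : ℂ) • c) := by
  have h : HasDerivAt (fun w : ℂ => (w - z₀) ^ (k + 1)) ((k + 1 : ℂ) * (z - z₀) ^ k) z := by
    have h := ((hasDerivAt_id z).sub_const z₀).pow (k + 1)
    simp only [id, Nat.cast_add, Nat.cast_one, add_tsub_cancel_right, mul_one] at h
    exact h
  rw [(h.hasFDerivAt_real_smul (hasFDerivAt_const c z)).wdel_eq]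
  simp
  match_scalars
  ring_nf
  simp
  ring

theorem wbar_sub {f g : ℂ → E} {z : ℂ} (hf : DifferentiableAt ℝ f z) (hg : DifferentiableAt ℝ g z) :
    wbar (fun w => f w - g w) z = wbar f z - wbar g z := by
  rw [HasFDerivAt.wbar_eq (f := fun w => f w - g w) (hf.hasFDerivAt.sub hg.hasFDerivAt), wbar, wbar]
  simp
  module

theorem wdel_sub {f g : ℂ → E} {z : ℂ} (hf : DifferentiableAt ℝ f z) (hg : DifferentiableAt ℝ g z) :
    wdel (fun w => f w - g w) z = wdel f z - wdel g z := by
  rw [HasFDerivAt.wdel_eq (f := fun w => f w - g w) (hf.hasFDerivAt.sub hg.hasFDerivAt), wdel, wdel]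
  simp
  module

variable (E) in
/-- The map `(ℂ →L[ℝ] E) → E` sending `df` to `∂f/∂z̄`. -/
def wbarCLM : (ℂ →L[ℝ] E) →L[ℝ] E :=
  (1 / 2 : ℂ) • (ContinuousLinearMap.apply ℝ E (1 : ℂ) +
    Complex.I • ContinuousLinearMap.apply ℝ E Complex.I)

variable (E) in
/-- The map `(ℂ →L[ℝ] E) → E` sending `df` to `∂f/∂z`. -/
def wdelCLM : (ℂ →L[ℝ] E) →L[ℝ] E :=
  (1 / 2 : ℂ) • (ContinuousLinearMap.apply ℝ E (1 : ℂ) -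
    Complex.I • ContinuousLinearMap.apply ℝ E Complex.I)

theorem _root_.ContDiffAt.wbar {f : ℂ → E} {z : ℂ} (hf : ContDiffAt ℝ ∞ f z) :
    ContDiffAt ℝ ∞ (wbar f) z :=
  (wbarCLM E).contDiff.contDiffAt.comp z (hf.fderiv_right (by exact_mod_cast le_top))

theorem _root_.ContDiffAt.wdel {f : ℂ → E} {z : ℂ} (hf : ContDiffAt ℝ ∞ f z) :
    ContDiffAt ℝ ∞ (wdel f) z :=
  (wdelCLM E).contDiff.contDiffAt.comp z (hf.fderiv_right (by exact_mod_cast le_top))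

theorem _root_.ContDiffAt.eventually_of_infty {F : Type*} [NormedAddCommGroup F] [NormedSpace ℝ F]
    {f : ℂ → F} {z : ℂ} (hf : ContDiffAt ℝ ∞ f z) (n : ℕ) : ∀ᶠ w in 𝓝 z, ContDiffAt ℝ n f w :=
  (hf.of_le (m := n) (by exact_mod_cast le_top)).eventually (by simp)

theorem wbar_wdel_comm {f : ℂ → E} {z : ℂ} (hf : ContDiffAt ℝ 2 f z) :
    wbar (wdel f) z = wdel (wbar f) z := by
  have hs := hf.isSymmSndFDerivAt (by simp)
  have hd : DifferentiableAt ℝ (fderiv ℝ f) z :=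
    (hf.fderiv_right (m := 1) (by norm_num)).differentiableAt (by simp)
  have h1 : HasFDerivAt (wdel f) ((wdelCLM E).comp (fderiv ℝ (fderiv ℝ f) z)) z :=
    (wdelCLM E).hasFDerivAt.comp z hd.hasFDerivAt
  have h2 : HasFDerivAt (wbar f) ((wbarCLM E).comp (fderiv ℝ (fderiv ℝ f) z)) z :=
    (wbarCLM E).hasFDerivAt.comp z hd.hasFDerivAt
  rw [h1.wbar_eq, h2.wdel_eq]
  have h3 := hs.eq Complex.I 1
  simp only [wbarCLM, wdelCLM, ContinuousLinearMap.comp_apply, _root_.smul_apply,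
    _root_.add_apply, _root_.sub_apply, ContinuousLinearMap.apply_apply]
  rw [h3]
  module

/-- The differential is a fixed real-linear function of the two Wirtinger derivatives, so vanishing
can be tested on them. -/
theorem VanishesTo.of_wirtinger {f : ℂ → E} {z₀ : ℂ} {k : ℕ} (hf : ContDiffAt ℝ ∞ f z₀)
    (h1 : VanishesTo k (wdel f) z₀) (h2 : VanishesTo k (wbar f) z₀) :
    VanishesTo k (fderiv ℝ f) z₀ := by
  let L1 : E →L[ℝ] ℂ →L[ℝ] E := (ContinuousLinearMap.lsmul ℝ ℂ : ℂ →L[ℝ] E →L[ℝ] E).flip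
  let L2 : E →L[ℝ] ℂ →L[ℝ] E :=
    (((ContinuousLinearMap.lsmul ℝ ℂ : ℂ →L[ℝ] E →L[ℝ] E)).comp
      (Complex.conjCLE : ℂ →L[ℝ] ℂ)).flip
  have h : fderiv ℝ f = fun z => L1 (wdel f z) + L2 (wbar f z) := by
    ext z v
    simp [L1, L2, fderiv_eq_wirtinger f z v]
  rw [h]
  exact (h1.clm hf.wdel L1).add (h2.clm hf.wbar L2)
    (L1.contDiff.contDiffAt.comp z₀ hf.wdel) (L2.contDiff.contDiffAt.comp z₀ hf.wbar)

/-- The leading Taylor polynomial is annihilated by `∂̄`, hence is a multiple of `(z - z₀)^k`. The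
induction applies the statement to `∂f`, whose `∂̄` is `∂(∂̄f)`, and integrates the leading term,
which accounts for the factor `(k + 1)⁻¹`. -/
theorem VanishesTo.exists_leading_term {k : ℕ} : ∀ {f : ℂ → E} {z₀ : ℂ}, ContDiffAt ℝ ∞ f z₀ →
    VanishesTo k f z₀ → VanishesTo k (wbar f) z₀ →
      ∃ c : E, VanishesTo (k + 1) (fun z => f z - (z - z₀) ^ k • c) z₀ := by
  induction k with
  | zero =>
    intro f z₀ _ _ _
    exact ⟨f z₀, vanishesTo_one_iff.2 (by simp)⟩
  | succ k ih =>
    intro f z₀ hf h1 h2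
    obtain ⟨h10, h11⟩ := vanishesTo_succ_iff.1 h1
    obtain ⟨h20, h21⟩ := vanishesTo_succ_iff.1 h2
    have hdf : ContDiffAt ℝ ∞ (fderiv ℝ f) z₀ := hf.fderiv_right (by exact_mod_cast le_top)
    have hdb : ContDiffAt ℝ ∞ (fderiv ℝ (wbar f)) z₀ :=
      hf.wbar.fderiv_right (by exact_mod_cast le_top)
    have h3 : VanishesTo k (wdel f) z₀ := h11.clm hdf (wdelCLM E)
    have h4 : VanishesTo k (wbar (wdel f)) z₀ := by
      refine (h21.clm hdb (wdelCLM E)).congr ?_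
      filter_upwards [hf.eventually_of_infty 2] with z hz
      rw [wbar_wdel_comm hz]
      rfl
    obtain ⟨c, hc⟩ := ih hf.wdel h3 h4
    have hk : (k + 1 : ℂ) ≠ 0 := by exact_mod_cast k.succ_ne_zero
    have hp : ∀ (n : ℕ) (c : E), ContDiff ℝ ∞ fun z => (z - z₀) ^ n • c := fun n c => by fun_prop
    refine ⟨(k + 1 : ℂ)⁻¹ • c, vanishesTo_succ_iff.2 ⟨by simp [h10], ?_⟩⟩
    have hd : ∀ᶠ z in 𝓝 z₀, DifferentiableAt ℝ f z :=
      (hf.eventually_of_infty 1).mono fun z hz => hz.differentiableAt (by simp)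
    refine VanishesTo.of_wirtinger (hf.sub (hp _ _).contDiffAt) (hc.congr ?_) (h2.congr ?_)
    · filter_upwards [hd] with z hz
      rw [wdel_sub hz ((hp _ _).differentiable (by simp)).differentiableAt, wdel_pow_smul,
        smul_inv_smul₀ hk]
    · filter_upwards [hd] with z hz
      rw [wbar_sub hz ((hp _ _).differentiable (by simp)).differentiableAt, wbar_pow_smul, sub_zero]

end Vanishing

/-! ### Unique continuation for `∂̄` -/

section UniqueContinuation

variable {E : Type*} [NormedAddCommGroup E] [NormedSpace ℂ E]

/-- Derivatives of arbitrary functions are measurable. This gives the integrability required by the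
divergence theorem when `w` is only differentiable off a countable set. -/
theorem stronglyMeasurable_wbar [FiniteDimensional ℂ E] (w : ℂ → E) :
    StronglyMeasurable (wbar w) := by
  have : FiniteDimensional ℝ E := FiniteDimensional.complexToReal E
  have : CompleteSpace E := FiniteDimensional.complete ℝ E
  have : ProperSpace E := FiniteDimensional.proper ℝ E
  have : SecondCountableTopology E := secondCountable_of_proper
  borelize E
  have h1 := (measurable_fderiv_apply_const ℝ w 1).stronglyMeasurable
  have h2 := (measurable_fderiv_apply_const ℝ w Complex.I).stronglyMeasurable
  exact (h1.add (h2.const_smul Complex.I)).const_smul (1 / 2 : ℂ)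

/-- This is the integrand of the boundary integral formula for a rectangle after the substitution `ζ
↦ a + exp ζ`. -/
theorem wbar_comp_exp (w : ℂ → E) (a ζ : ℂ) :
    Complex.I • (fderiv ℝ w (a + Complex.exp ζ)) (Complex.exp ζ) -
      fderiv ℝ w (a + Complex.exp ζ) (Complex.exp ζ * Complex.I) =
      (2 * Complex.I * (starRingEnd ℂ) (Complex.exp ζ)) • wbar w (a + Complex.exp ζ) := by
  rw [fderiv_eq_wirtinger, fderiv_eq_wirtinger]
  simp only [map_mul, Complex.conj_I]
  module

/-- The mean of `w` over a small circle is controlled by `∂̄w`. -/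
theorem norm_integral_circle_le [FiniteDimensional ℂ E] {w : ℂ → E} {B : ℝ} (hB0 : 0 ≤ B)
    (hc : Continuous w) {s : Set ℂ} (hsc : s.Countable) (hd : ∀ z ∉ s, DifferentiableAt ℝ w z)
    (hB : ∀ z ∉ s, ‖wbar w z‖ ≤ B) (a : ℂ) {t b : ℝ} (htb : t ≤ b)
    (hb : ∀ y : ℝ, w (a + Complex.exp (b + y * Complex.I)) = 0) :
    ‖∫ y in (0 : ℝ)..2 * Real.pi, w (a + Complex.exp (t + y * Complex.I))‖ ≤
      4 * Real.pi * B * Real.exp b := by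
  classical
  have : FiniteDimensional ℝ E := FiniteDimensional.complexToReal E
  have : CompleteSpace E := FiniteDimensional.complete ℝ E
  have hpi := Real.pi_pos
  -- In logarithmic polar coordinates the annulus around `a` becomes the rectangle `t ≤ Re ζ ≤ b`,
  -- `0 ≤ Im ζ ≤ 2π`. The horizontal sides cancel by periodicity and `w` vanishes on the side `Re ζ
  -- = b`, so the integral over the inner circle equals an area integral of `∂̄w`.
  let φ : ℂ → ℂ := fun ζ => a + Complex.exp ζ
  have hφ : Continuous φ := by fun_prop
  let s' : Set ℂ := φ ⁻¹' s
  have hs' : s'.Countable := by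
    have : s' = Complex.exp ⁻¹' ((fun z => a + z) ⁻¹' s) := rfl
    rw [this]
    exact (hsc.preimage (add_right_injective a)).preimage_cexp
  -- The value `0` on the exceptional set keeps the integrand `k` bounded and measurable everywhere.
  let f' : ℂ → ℂ →L[ℝ] E := fun ζ => if ζ ∈ s' then 0 else
    (fderiv ℝ w (φ ζ)).comp ((ContinuousLinearMap.toSpanSingleton ℂ (Complex.exp ζ)).restrictScalars ℝ)
  let k : ℂ → E := fun ζ => Complex.I • f' ζ 1 - f' ζ Complex.I
  have hk : k = s'ᶜ.indicator (fun ζ => (2 * Complex.I * (starRingEnd ℂ) (Complex.exp ζ)) •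
      wbar w (φ ζ)) := by
    funext ζ
    by_cases hζ : ζ ∈ s'
    · simp [k, f', hζ]
    · rw [Set.indicator_of_mem (by exact hζ), ← wbar_comp_exp]
      simp only [k, f', hζ, if_false]
      simp [φ, mul_comm]
  have hkb : ∀ ζ, ‖k ζ‖ ≤ 2 * Real.exp ζ.re * B := by
    intro ζ
    rw [hk]
    by_cases hζ : ζ ∈ s'
    · rw [Set.indicator_of_notMem (by simpa using hζ), norm_zero]; positivity
    · rw [Set.indicator_of_mem (by exact hζ), norm_smul]
      have h1 : ‖(2 * Complex.I * (starRingEnd ℂ) (Complex.exp ζ))‖ = 2 * Real.exp ζ.re := by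
        simp [Complex.norm_exp]
      rw [h1]
      gcongr
      exact hB _ hζ
  have hkm : StronglyMeasurable k := by
    rw [hk]
    refine StronglyMeasurable.indicator ?_ hs'.measurableSet.compl
    refine StronglyMeasurable.smul (f := fun ζ => 2 * Complex.I * (starRingEnd ℂ) (Complex.exp ζ)) ?_ ?_
    · exact (by fun_prop : Continuous _).stronglyMeasurable
    · exact (stronglyMeasurable_wbar w).comp_measurable hφ.measurable
  have key := Complex.integral_boundary_rect_of_hasFDerivAt_real_off_countable (fun ζ => w (φ ζ)) f'
    (t : ℂ) (b + (2 * Real.pi : ℝ) * Complex.I) s' hs' (by fun_prop) ?_ ?_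
  rotate_left
  · intro ζ hζ
    have hζ' : ζ ∉ s' := hζ.2
    have h1 : HasFDerivAt φ ((ContinuousLinearMap.toSpanSingleton ℂ (Complex.exp ζ)).restrictScalars ℝ) ζ :=
      ((Complex.hasDerivAt_exp ζ).const_add a).hasFDerivAt.restrictScalars ℝ
    have h2 := (hd _ hζ').hasFDerivAt.comp ζ h1
    simp only [f', hζ', if_false]
    exact h2
  · refine Measure.integrableOn_of_bounded (M := 2 * Real.exp b * B) ?_ hkm.aestronglyMeasurable ?_
    · exact ((isCompact_uIcc.reProdIm isCompact_uIcc).measure_lt_top).ne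
    · refine (ae_restrict_iff' ?_).2 (Filter.Eventually.of_forall fun ζ hζ => ?_)
      · exact (isCompact_uIcc.reProdIm isCompact_uIcc).measurableSet
      · refine (hkb ζ).trans ?_
        have : ζ.re ≤ b := by
          have := hζ.1
          simp [uIcc_of_le htb] at this
          exact this.2
        gcongr
  have hper : ∀ x : ℝ, φ (x + (2 * Real.pi : ℝ) * Complex.I) = φ x := by
    intro x
    have := Complex.exp_periodic (x : ℂ)
    simp only [φ]
    rw [← this]
    push_cast
    rfl
  simp only [Complex.add_re, Complex.ofReal_re, Complex.mul_re, Complex.I_re, Complex.I_im,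
    Complex.ofReal_im, Complex.add_im, Complex.mul_im, mul_zero, mul_one, zero_mul,
    add_zero, zero_add, Complex.ofReal_zero, hper, sub_self] at key
  have h0 : ∀ y : ℝ, w (φ (b + y * Complex.I)) = 0 := hb
  simp only [h0, intervalIntegral.integral_zero, smul_zero, zero_sub] at key
  have h1 : ‖∫ y in (0 : ℝ)..2 * Real.pi, w (φ (t + y * Complex.I))‖ =
      ‖∫ x in t..b, ∫ y in (0 : ℝ)..2 * Real.pi, k (x + y * Complex.I)‖ := by
    rw [← key, norm_neg, norm_smul, Complex.norm_I, one_mul]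
  change ‖∫ y in (0 : ℝ)..2 * Real.pi, w (φ (t + y * Complex.I))‖ ≤ _
  rw [h1]
  -- The integrand is at most `2 B e^x` over an interval of length `2π`; integrating in `x` then
  -- gives `4πB (e^b - e^t)`.
  have h2 : ∀ x : ℝ, ‖∫ y in (0 : ℝ)..2 * Real.pi, k (x + y * Complex.I)‖ ≤
      4 * Real.pi * B * Real.exp x := by
    intro x
    have := intervalIntegral.norm_integral_le_of_norm_le_const (a := 0) (b := 2 * Real.pi)
      (f := fun y : ℝ => k (x + y * Complex.I)) (C := 2 * Real.exp x * B) (by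
        intro y _
        simpa using hkb (x + y * Complex.I))
    rw [sub_zero, abs_of_pos (by positivity)] at this
    linarith
  have h3 := intervalIntegral.norm_integral_le_of_norm_le (μ := volume) htb
    (f := fun x : ℝ => ∫ y in (0 : ℝ)..2 * Real.pi, k (x + y * Complex.I))
    (Filter.Eventually.of_forall fun x _ => h2 x)
    (Continuous.intervalIntegrable (u := fun x : ℝ => 4 * Real.pi * B * Real.exp x)
      (by fun_prop) t b)
  refine h3.trans ?_
  rw [intervalIntegral.integral_const_mul, integral_exp]
  have := Real.exp_pos t
  gcongr
  linarith

/-- If `w` is supported in the disc of radius `R`, then `|w|` is bounded by `4 R sup |∂̄w|`. -/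
theorem norm_le_of_norm_wbar_le [FiniteDimensional ℂ E] {w : ℂ → E} {z₀ : ℂ} {R B : ℝ} (hR : 0 < R)
    (hB0 : 0 ≤ B) (hc : Continuous w) (hs : ∀ z, R ≤ ‖z - z₀‖ → w z = 0)
    {s : Set ℂ} (hsc : s.Countable) (hd : ∀ z ∉ s, DifferentiableAt ℝ w z)
    (hB : ∀ z ∉ s, ‖wbar w z‖ ≤ B) (a : ℂ) : ‖w a‖ ≤ 4 * R * B := by
  have : FiniteDimensional ℝ E := FiniteDimensional.complexToReal E
  have : CompleteSpace E := FiniteDimensional.complete ℝ E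
  rcases le_or_gt R ‖a - z₀‖ with ha | ha
  · rw [hs a ha, norm_zero]; positivity
  have hpi := Real.pi_pos
  refine le_of_forall_pos_le_add fun ε hε => ?_
  obtain ⟨δ, hδ, hδ'⟩ := Metric.continuousAt_iff.1 (hc.continuousAt (x := a)) ε hε
  -- As `‖a - z₀‖ < R`, the circle of radius `2R` around `a` lies outside the disc supporting `w`.
  -- The inner radius `exp t` is below `δ`, so the mean over the inner circle is within `ε` of `w
  -- a`.
  set b := Real.log (2 * R)
  have hb : Real.exp b = 2 * R := Real.exp_log (by positivity)
  set t := min b (Real.log (δ / 2))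
  have ht : Real.exp t < δ := by
    calc Real.exp t ≤ Real.exp (Real.log (δ / 2)) := Real.exp_le_exp.2 (min_le_right _ _)
      _ = δ / 2 := Real.exp_log (by positivity)
      _ < δ := by linarith
  have h1 := norm_integral_circle_le hB0 hc hsc hd hB a (t := t) (b := b) (min_le_left _ _) (by
    intro y
    apply hs
    have h2 : ‖Complex.exp (b + y * Complex.I)‖ = 2 * R := by
      rw [Complex.norm_exp]; simp [hb]
    have h3 : a + Complex.exp (b + y * Complex.I) - z₀ =
      Complex.exp (b + y * Complex.I) - (-(a - z₀)) := by ring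
    rw [h3]
    have := norm_sub_norm_le (Complex.exp (b + y * Complex.I)) (-(a - z₀))
    rw [h2, norm_neg] at this
    linarith)
  have h4 : ‖∫ y in (0 : ℝ)..2 * Real.pi, (w a - w (a + Complex.exp (t + y * Complex.I)))‖ ≤
      ε * (2 * Real.pi) := by
    have := intervalIntegral.norm_integral_le_of_norm_le_const (a := 0) (b := 2 * Real.pi)
      (f := fun y : ℝ => w a - w (a + Complex.exp (t + y * Complex.I))) (C := ε) (by
        intro y _
        rw [norm_sub_rev, ← dist_eq_norm]
        refine (hδ' ?_).le
        simp [Complex.norm_exp, ht])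
    rwa [sub_zero, abs_of_pos (by positivity)] at this
  rw [intervalIntegral.integral_sub (by simp) (Continuous.intervalIntegrable (by fun_prop) _ _),
    intervalIntegral.integral_const, sub_zero] at h4
  have h5 := norm_le_norm_add_norm_sub' ((2 * Real.pi) • w a)
    (∫ y in (0 : ℝ)..2 * Real.pi, w (a + Complex.exp (t + y * Complex.I)))
  rw [norm_smul, Real.norm_of_nonneg (by positivity : (0 : ℝ) ≤ 2 * Real.pi)] at h5
  rw [hb] at h1
  have h6 : 2 * Real.pi * ‖w a‖ ≤ 2 * Real.pi * (4 * R * B + ε) := by nlinarith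
  exact le_of_mul_le_mul_left h6 (by positivity)

/-- A smooth solution of `|∂̄U| ≤ C |U|` which vanishes to infinite order vanishes identically. -/
theorem eventually_eq_zero_of_vanishesTo [FiniteDimensional ℂ E] {U : ℂ → E} {z₀ : ℂ}
    (hU : ContDiffAt ℝ ∞ U z₀) {C : ℝ} (hC : ∀ᶠ z in 𝓝 z₀, ‖wbar U z‖ ≤ C * ‖U z‖)
    (hv : ∀ k, VanishesTo k U z₀) : ∀ᶠ z in 𝓝 z₀, U z = 0 := by
  obtain ⟨r₀, hr₀, hball⟩ := Metric.eventually_nhds_iff_ball.1 (hC.and (hU.eventually_of_infty 1))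
  have hdU : ∀ z ∈ Metric.ball z₀ r₀, DifferentiableAt ℝ U z := fun z hz =>
    (hball z hz).2.differentiableAt (by simp)
  -- The radius makes `4 r |C| ≤ 1/2`, so that the term `C ‖W‖` in the sup estimate can be absorbed.
  set r : ℝ := min (r₀ / 2) (1 / (8 * (|C| + 1)))
  have hr : 0 < r := by positivity
  have hrr : r < r₀ := (min_le_left _ _).trans_lt (by linarith)
  have hrC : 4 * r * |C| ≤ 1 / 2 := by
    have h1 : r ≤ 1 / (8 * (|C| + 1)) := min_le_right _ _
    rw [le_div_iff₀ (by positivity)] at h1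
    nlinarith [abs_nonneg C]
  have hsub : Metric.closedBall z₀ r ⊆ Metric.ball z₀ r₀ := Metric.closedBall_subset_ball hrr
  let χ : ContDiffBump z₀ := ⟨r / 2, r, by positivity, by linarith⟩
  have hχd : Differentiable ℝ χ := (χ.contDiff (n := 1)).differentiable (by simp)
  have hχc : Continuous (fderiv ℝ χ) := (χ.contDiff (n := 1)).continuous_fderiv (by simp)
  have hχ0 : ∀ z, r ≤ ‖z - z₀‖ → χ z = 0 := fun z hz =>
    χ.zero_of_le_dist (by rwa [dist_eq_norm])
  let V : ℂ → E := fun z => χ z • U z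
  have hV0 : ∀ z, z ∉ Metric.closedBall z₀ r → V =ᶠ[𝓝 z] 0 := by
    intro z hz
    filter_upwards [Metric.isClosed_closedBall.isOpen_compl.mem_nhds hz] with y hy
    simp only [Metric.mem_closedBall, Set.mem_compl_iff, not_le, dist_eq_norm] at hy
    simp [V, hχ0 y hy.le]
  have hVd : Differentiable ℝ V := by
    intro z
    by_cases hz : z ∈ Metric.ball z₀ r₀
    · exact (hχd z).smul (hdU z hz)
    · exact (hV0 z fun h => hz (hsub h)).differentiableAt_iff.2 (differentiableAt_const _)
  have hUc : ContinuousOn U (Metric.closedBall z₀ r) := fun z hz =>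
    (hdU z (hsub hz)).continuousAt.continuousWithinAt
  obtain ⟨K, hK⟩ := (isCompact_closedBall z₀ r).exists_bound_of_continuousOn
    (f := fun z => ‖fderiv ℝ χ z‖ * ‖U z‖) (hχc.norm.continuousOn.mul hUc.norm)
  have hK0 : 0 ≤ K := (norm_nonneg _).trans (hK z₀ (Metric.mem_closedBall_self hr.le))
  have hwV : ∀ z ∈ Metric.closedBall z₀ r, ‖wbar V z‖ ≤
      |C| * ‖V z‖ + ‖fderiv ℝ χ z‖ * ‖U z‖ := by
    intro z hz
    have h1 : wbar V z = χ z • wbar U z + (1 / 2 : ℂ) • (fderiv ℝ χ z 1 • U z +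
        Complex.I • fderiv ℝ χ z Complex.I • U z) := by
      rw [HasFDerivAt.wbar_eq (f := V) ((hχd z).hasFDerivAt.smul (hdU z (hsub hz)).hasFDerivAt), wbar]
      simp only [_root_.add_apply, _root_.smul_apply, ContinuousLinearMap.smulRight_apply]
      module
    have h2 : ‖(1 / 2 : ℂ) • (fderiv ℝ χ z 1 • U z + Complex.I • fderiv ℝ χ z Complex.I • U z)‖ ≤
        ‖fderiv ℝ χ z‖ * ‖U z‖ := by
      have h3 := (fderiv ℝ χ z).le_opNorm 1
      have h4 := (fderiv ℝ χ z).le_opNorm Complex.I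
      rw [norm_one, mul_one] at h3
      rw [Complex.norm_I, mul_one] at h4
      rw [norm_smul]
      have h5 := norm_add_le (fderiv ℝ χ z 1 • U z) (Complex.I • fderiv ℝ χ z Complex.I • U z)
      rw [norm_smul, norm_smul, norm_smul, Complex.norm_I, one_mul] at h5
      have h6 : ‖(1 / 2 : ℂ)‖ = 1 / 2 := by simp
      rw [h6]
      have := norm_nonneg (U z)
      nlinarith
    have h3 : ‖χ z • wbar U z‖ ≤ |C| * ‖V z‖ := by
      rw [norm_smul, norm_smul, mul_left_comm]
      gcongr
      refine (hball z (hsub hz)).1.trans ?_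
      gcongr
      exact le_abs_self C
    rw [h1]
    exact (norm_add_le _ _).trans (add_le_add h3 h2)
  have main : ∀ n : ℕ, ∀ z ∈ Metric.ball z₀ (r / 2), z ≠ z₀ →
      ‖U z‖ ≤ 8 * r * K * (‖z - z₀‖ * (2 / r)) ^ (n + 1) := by
    intro n
    -- The weight is holomorphic off `z₀`, so it commutes with `∂̄` and preserves the inequality
    -- `|∂̄U| ≤ C |U|`. Vanishing of infinite order makes `W` continuous at `z₀` for every `n`.
    let W : ℂ → E := fun z => ((z - z₀) ^ (n + 1))⁻¹ • V z
    have hW0 : ∀ z, r ≤ ‖z - z₀‖ → W z = 0 := fun z hz => by simp [W, V, hχ0 z hz]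
    have hφ : ∀ z, z ≠ z₀ → DifferentiableAt ℂ (fun z : ℂ => ((z - z₀) ^ (n + 1))⁻¹) z := by
      intro z hz
      have : (z - z₀) ^ (n + 1) ≠ 0 := pow_ne_zero _ (sub_ne_zero.2 hz)
      fun_prop (disch := assumption)
    have hWd : ∀ z, z ≠ z₀ → DifferentiableAt ℝ W z := fun z hz =>
      ((hφ z hz).restrictScalars ℝ).smul (hVd z)
    have hWc : Continuous W := by
      refine continuous_iff_continuousAt.2 fun z => ?_
      rcases eq_or_ne z z₀ with rfl | hz
      · have hWz : W z = 0 := by simp [W]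
        rw [ContinuousAt, hWz, tendsto_zero_iff_norm_tendsto_zero]
        obtain ⟨L, hL0, hL⟩ := ((hv (n + 2)).isBigO hU).exists_nonneg
        have hlim : Filter.Tendsto (fun y => L * ‖y - z‖) (𝓝 z) (𝓝 0) := by
          have : Continuous (fun y => L * ‖y - z‖) := by fun_prop
          simpa using this.tendsto z
        refine squeeze_zero' (Filter.Eventually.of_forall fun y => norm_nonneg _) ?_ hlim
        filter_upwards [hL.bound] with y hy
        rcases eq_or_ne y z with rfl | hyz
        · simp [W]
        have hpos : 0 < ‖y - z‖ := norm_pos_iff.2 (sub_ne_zero.2 hyz)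
        simp only [W, V, norm_smul, norm_inv, norm_pow]
        rw [norm_pow, norm_norm] at hy
        have h1 : ‖χ y‖ ≤ 1 := by
          rw [Real.norm_of_nonneg χ.nonneg]; exact χ.le_one
        rw [inv_mul_le_iff₀ (by positivity)]
        calc ‖χ y‖ * ‖U y‖ ≤ 1 * (L * ‖y - z‖ ^ (n + 2)) := by gcongr
          _ = _ := by ring
      · exact (hWd z hz).continuousAt
    obtain ⟨z₁, hz₁, hmax⟩ := (isCompact_closedBall z₀ r).exists_isMaxOn
      ⟨z₀, Metric.mem_closedBall_self hr.le⟩ hWc.norm.continuousOn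
    have hS : ∀ z, ‖W z‖ ≤ ‖W z₁‖ := by
      intro z
      by_cases hz : z ∈ Metric.closedBall z₀ r
      · exact hmax hz
      · rw [hW0 z, norm_zero]
        · positivity
        · simp only [Metric.mem_closedBall, not_le, dist_eq_norm] at hz
          exact hz.le
    -- The error from the cutoff lives where `‖z - z₀‖ ≥ r / 2`, and there the weight is at most `(2
    -- / r)^(n + 1)`.
    have hwW : ∀ z ∉ ({z₀} : Set ℂ), ‖wbar W z‖ ≤ |C| * ‖W z₁‖ + K * (2 / r) ^ (n + 1) := by
      intro z hz
      have hz : z ≠ z₀ := hz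
      have hpos : 0 < ‖z - z₀‖ := norm_pos_iff.2 (sub_ne_zero.2 hz)
      rw [wbar_smul (hφ z hz) (hVd z), norm_smul]
      by_cases hzr : z ∈ Metric.closedBall z₀ r
      · have h1 : ‖((z - z₀) ^ (n + 1))⁻¹‖ * (|C| * ‖V z‖) ≤ |C| * ‖W z₁‖ := by
          rw [mul_left_comm, ← norm_smul]
          gcongr
          exact hS z
        have h2 : ‖((z - z₀) ^ (n + 1))⁻¹‖ * (‖fderiv ℝ χ z‖ * ‖U z‖) ≤ K * (2 / r) ^ (n + 1) := by
          rcases lt_or_ge ‖z - z₀‖ (r / 2) with h | h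
          · have h3 : fderiv ℝ χ z = 0 := by
              have : (χ : ℂ → ℝ) =ᶠ[𝓝 z] fun _ => 1 :=
                χ.eventuallyEq_one_of_mem_ball (by simpa [dist_eq_norm] using h)
              rw [this.fderiv_eq]; simp
            rw [h3]
            simp only [norm_zero, zero_mul, mul_zero]
            positivity
          · have h4 := (le_abs_self _).trans (hK z hzr)
            rw [mul_comm]
            have h5 : ‖((z - z₀) ^ (n + 1))⁻¹‖ ≤ (2 / r) ^ (n + 1) := by
              rw [norm_inv, norm_pow, ← inv_pow]
              gcongr
              rw [inv_le_comm₀ hpos (by positivity)]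
              simpa using h
            gcongr
        calc _ ≤ ‖((z - z₀) ^ (n + 1))⁻¹‖ * (|C| * ‖V z‖ + ‖fderiv ℝ χ z‖ * ‖U z‖) := by
              gcongr
              exact hwV z hzr
          _ ≤ _ := by rw [mul_add]; exact add_le_add h1 h2
      · have : wbar V z = 0 := by
          rw [wbar_congr (hV0 z hzr)]
          simp [wbar]
        rw [this]
        simp only [norm_zero, mul_zero]
        positivity
    have h1 := norm_le_of_norm_wbar_le (z₀ := z₀) hr (by positivity) hWc hW0
      (Set.countable_singleton z₀) (fun z hz => hWd z hz) hwW z₁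
    -- The sup estimate at the maximum point `z₁` bounds `‖W z₁‖` by half of itself plus the cutoff
    -- error.
    have h2 : ‖W z₁‖ ≤ 8 * r * K * (2 / r) ^ (n + 1) := by
      have : 4 * r * |C| * ‖W z₁‖ ≤ 1 / 2 * ‖W z₁‖ := by gcongr
      linarith
    intro z hz hzz
    have hχ1 : χ z = 1 := χ.one_of_mem_closedBall (Metric.ball_subset_closedBall hz)
    have hpos : 0 < ‖z - z₀‖ := norm_pos_iff.2 (sub_ne_zero.2 hzz)
    have h3 := (hS z).trans h2
    simp only [W, V, hχ1, one_smul, norm_smul, norm_inv, norm_pow] at h3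
    rw [inv_mul_le_iff₀ (by positivity)] at h3
    rw [mul_pow]
    linarith
  filter_upwards [Metric.ball_mem_nhds z₀ (by positivity : 0 < r / 2)] with z hz
  rcases eq_or_ne z z₀ with rfl | hzz
  · exact vanishesTo_one_iff.1 (hv 1)
  · have hlt : ‖z - z₀‖ * (2 / r) < 1 := by
      rw [Metric.mem_ball, dist_eq_norm] at hz
      rw [mul_div_assoc', div_lt_one hr]
      linarith
    -- On the disc of radius `r / 2` the ratio `2 ‖z - z₀‖ / r` is less than `1`, so letting the
    -- weight exponent grow forces `U z = 0`.
    have h1 : Filter.Tendsto (fun n : ℕ => 8 * r * K * (‖z - z₀‖ * (2 / r)) ^ (n + 1))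
        Filter.atTop (𝓝 (8 * r * K * 0)) :=
      ((Filter.tendsto_add_atTop_iff_nat 1).2
        (tendsto_pow_atTop_nhds_zero_of_lt_one (by positivity) hlt)).const_mul _
    rw [mul_zero] at h1
    exact norm_le_zero_iff.1 (ge_of_tendsto' h1 fun n => main n z hz hzz)

end UniqueContinuation

/-! ### Zeros of solutions of `∂̄U = A K(U)` -/

section LocalStructure

variable {E : Type*} [NormedAddCommGroup E] [NormedSpace ℂ E]

/-- Solutions of `∂̄U = A K(U)` either vanish identically near a point or have a zero of finite
order there, and a continuous nonvanishing reduced representative. -/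
theorem eventually_eq_zero_or_exists_pow_smul [FiniteDimensional ℂ E] {U : ℂ → E} {z₀ : ℂ}
    (hU : ContDiffAt ℝ ∞ U z₀) {A : ℂ → ℂ} (hA : ContDiffAt ℝ ∞ A z₀) (K : E →L[ℝ] E)
    (hUA : ∀ᶠ z in 𝓝 z₀, wbar U z = A z • K (U z)) :
    (∀ᶠ z in 𝓝 z₀, U z = 0) ∨ ∃ (k : ℕ) (w : ℂ → E), ContinuousAt w z₀ ∧ w z₀ ≠ 0 ∧
      ∀ z, z ≠ z₀ → U z = (z - z₀) ^ k • w z := by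
  classical
  by_cases h : ∀ k, VanishesTo k U z₀
  · left
    refine eventually_eq_zero_of_vanishesTo hU (C := (‖A z₀‖ + 1) * ‖K‖) ?_ h
    have h1 : ∀ᶠ z in 𝓝 z₀, ‖A z‖ < ‖A z₀‖ + 1 :=
      hA.continuousAt.norm.eventually_lt continuousAt_const (by linarith)
    filter_upwards [hUA, h1] with z hz hz1
    rw [hz, norm_smul, mul_assoc]
    gcongr
    exact K.le_opNorm _
  · right
    push Not at h
    -- Here `n` is the least order to which vanishing fails. It is positive because vanishing to
    -- order `0` is an empty condition, and the order of the zero is `k = n - 1`.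
    let n := Nat.find h
    have hn : ¬ VanishesTo n U z₀ := Nat.find_spec h
    have hn0 : n ≠ 0 := by
      intro h0
      rw [h0] at hn
      exact hn fun j hj => by omega
    obtain ⟨k, hk⟩ := Nat.exists_eq_succ_of_ne_zero hn0
    have hVk : VanishesTo k U z₀ := by
      by_contra hcon
      have := Nat.find_min' h hcon
      change n ≤ k at this
      omega
    have hB : VanishesTo k (wbar U) z₀ := by
      let B : ℂ →L[ℝ] E →L[ℝ] E :=
        (((ContinuousLinearMap.lsmul ℝ ℂ : ℂ →L[ℝ] E →L[ℝ] E)).flip.comp K).flip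
      refine (VanishesTo.bilinear B hVk hA hU).congr ?_
      filter_upwards [hUA] with z hz
      rw [hz]
      rfl
    obtain ⟨c, hc⟩ := hVk.exists_leading_term hU hB
    have hp : ContDiff ℝ ∞ fun z : ℂ => (z - z₀) ^ k • c := by fun_prop
    have hc0 : c ≠ 0 := by
      rintro rfl
      apply hn
      rw [hk]
      exact hc.congr (by simp)
    refine ⟨k, Function.update (fun z => ((z - z₀) ^ k)⁻¹ • U z) z₀ c, ?_, by simpa using hc0, ?_⟩
    · rw [continuousAt_update_same, tendsto_iff_norm_sub_tendsto_zero]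
      obtain ⟨L, hL0, hL⟩ := (hc.isBigO (hU.sub hp.contDiffAt)).exists_nonneg
      have hlim : Filter.Tendsto (fun y => L * ‖y - z₀‖) (𝓝[≠] z₀) (𝓝 0) := by
        have : Continuous (fun y => L * ‖y - z₀‖) := by fun_prop
        simpa using (this.tendsto z₀).mono_left nhdsWithin_le_nhds
      refine squeeze_zero' (Filter.Eventually.of_forall fun y => norm_nonneg _) ?_ hlim
      filter_upwards [nhdsWithin_le_nhds hL.bound, self_mem_nhdsWithin] with y hy hyz
      have hyz' : (y - z₀) ^ k ≠ 0 := pow_ne_zero _ (sub_ne_zero.2 hyz)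
      have hpos : 0 < ‖y - z₀‖ := norm_pos_iff.2 (sub_ne_zero.2 hyz)
      have h1 : ((y - z₀) ^ k)⁻¹ • U y - c = ((y - z₀) ^ k)⁻¹ • (U y - (y - z₀) ^ k • c) := by
        rw [smul_sub, inv_smul_smul₀ hyz']
      rw [h1, norm_smul, norm_inv, norm_pow, inv_mul_le_iff₀ (by positivity)]
      rw [norm_pow, norm_norm] at hy
      exact hy.trans_eq (by ring)
    · intro z hz
      rw [Function.update_of_ne hz, smul_inv_smul₀ (pow_ne_zero _ (sub_ne_zero.2 hz))]

end LocalStructure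

/-! ### The topology of the projective line -/

theorem continuous_mk_CP1 : Continuous fun v : {v : EuclideanSpace ℂ (Fin 2) // v ≠ 0} =>
    (Projectivization.mk ℂ v.1 v.2 : CP1) :=
  continuous_quotient_mk'

/-- The orthogonal projection onto a line, as a matrix. -/
def lineProjection (v : EuclideanSpace ℂ (Fin 2)) : Fin 2 → Fin 2 → ℂ :=
  fun i j => v i * (starRingEnd ℂ) (v j) / ((‖v‖ : ℂ) ^ 2)

theorem lineProjection_smul (v : EuclideanSpace ℂ (Fin 2)) {c : ℂ} (hc : c ≠ 0) :
    lineProjection (c • v) = lineProjection v := by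
  funext i j
  have h : ((‖c‖ : ℂ)) ^ 2 = c * (starRingEnd ℂ) c := by
    rw [Complex.mul_conj, Complex.normSq_eq_norm_sq]; norm_cast
  have hc' : (starRingEnd ℂ) c ≠ 0 := by simpa using hc
  simp only [lineProjection, norm_smul, PiLp.smul_apply, smul_eq_mul, map_mul, Complex.ofReal_mul,
    mul_pow, h]
  rw [show c * v i * ((starRingEnd ℂ) c * (starRingEnd ℂ) (v j)) =
    (c * (starRingEnd ℂ) c) * (v i * (starRingEnd ℂ) (v j)) by ring,
    mul_div_mul_left _ _ (mul_ne_zero hc hc')]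

theorem exists_smul_eq_of_lineProjection_eq {v w : EuclideanSpace ℂ (Fin 2)} (hv : v ≠ 0)
    (hw : w ≠ 0) (h : lineProjection v = lineProjection w) : ∃ c : ℂ, c • w = v := by
  obtain ⟨j, hj⟩ : ∃ j, v j ≠ 0 := by
    by_contra hcon
    push Not at hcon
    exact hv (by ext i; simpa using hcon i)
  have hv2 : (‖v‖ : ℂ) ≠ 0 := by simpa using hv
  have hw2 : (‖w‖ : ℂ) ≠ 0 := by simpa using hw
  have hj' : (starRingEnd ℂ) (v j) ≠ 0 := by simpa using hj
  refine ⟨(starRingEnd ℂ) (w j) / (‖w‖ : ℂ) ^ 2 * ((‖v‖ : ℂ) ^ 2 / (starRingEnd ℂ) (v j)), ?_⟩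
  ext i
  have h1 : v i * (starRingEnd ℂ) (v j) / ((‖v‖ : ℂ) ^ 2) =
    w i * (starRingEnd ℂ) (w j) / ((‖w‖ : ℂ) ^ 2) := congrFun (congrFun h i) j
  simp only [PiLp.smul_apply, smul_eq_mul]
  field_simp at h1 ⊢
  linear_combination -h1

/-- A line is determined by its orthogonal projection, which embeds the projective line continuously
and injectively in a space of matrices. -/
instance : T2Space CP1 := by
  let f : CP1 → Fin 2 → Fin 2 → ℂ := Projectivization.lift (fun v => lineProjection v.1) (by
    rintro ⟨v, hv⟩ ⟨w, hw⟩ t (h : v = t • w)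
    have ht : t ≠ 0 := by
      rintro rfl
      exact hv (by simpa using h)
    simp only [h, lineProjection_smul w ht])
  have hf : Continuous f := by
    refine Continuous.quotient_lift ?_ _
    refine continuous_pi fun i => continuous_pi fun j => ?_
    refine Continuous.div (by fun_prop) (by fun_prop) fun v => ?_
    have := v.2
    simpa using this
  refine T2Space.of_injective_continuous (f := f) ?_ hf
  intro p q hpq
  induction p using Projectivization.ind with
  | h v hv =>
    induction q using Projectivization.ind with
    | h w hw =>
      exact (Projectivization.mk_eq_mk_iff' ℂ v w hv hw).2
        (exists_smul_eq_of_lineProjection_eq hv hw hpq)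

theorem continuousAt_mk_CP1 {X : Type*} [TopologicalSpace X] {w : X → EuclideanSpace ℂ (Fin 2)}
    {x : X} (hw : ContinuousAt w x) (h0 : w x ≠ 0) {Ψ : X → CP1}
    (h : ∀ᶠ y in 𝓝 x, ∀ hy : w y ≠ 0, Ψ y = Projectivization.mk ℂ (w y) hy) :
    ContinuousAt Ψ x := by
  classical
  -- Where `w` vanishes the default `w x` is used; this does not occur near `x`.
  let w' : X → {v : EuclideanSpace ℂ (Fin 2) // v ≠ 0} := fun y =>
    if hy : w y ≠ 0 then ⟨w y, hy⟩ else ⟨w x, h0⟩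
  have hne : ∀ᶠ y in 𝓝 x, w y ≠ 0 := hw.eventually_ne h0
  have hw' : ContinuousAt w' x := by
    refine (Topology.IsInducing.subtypeVal
      (t := {v : EuclideanSpace ℂ (Fin 2) | v ≠ 0})).continuousAt_iff.2 (hw.congr ?_)
    filter_upwards [hne] with y hy
    simp [w', hy]
  refine (continuous_mk_CP1.continuousAt.comp hw').congr ?_
  filter_upwards [hne, h] with y hy hy2
  rw [hy2 hy]
  simp [w', hy]

/-! ### Coordinate fields and Hermitian metrics -/

section Metric

variable {M : Type*} [TopologicalSpace M] [ChartedSpace ℂ M]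

theorem baseVec_ne_zero (x : M) : baseVec x ≠ 0 := one_ne_zero (α := ℂ)

theorem HermitianMetric.normSq_smul (g : HermitianMetric M) (x : M) (c : ℂ)
    (v : TangentSpace 𝓘(ℂ, ℂ) x) : g.normSq x (c • v) = ‖c‖ ^ 2 * g.normSq x v := by
  simp only [normSq, map_smul, LinearMap.map_smulₛₗ, LinearMap.smul_apply, smul_eq_mul]
  rw [← mul_assoc, mul_comm ((starRingEnd ℂ) c) c, Complex.mul_conj, Complex.re_ofReal_mul,
    Complex.normSq_eq_norm_sq]

/-- The component of a tangent vector at `x` with respect to `baseVec x`. -/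
def tangentCoord (x : M) (v : TangentSpace 𝓘(ℂ, ℂ) x) : ℂ := v

theorem tangent_eq_smul_baseVec (x : M) (v : TangentSpace 𝓘(ℂ, ℂ) x) :
    v = tangentCoord x v • baseVec x := (mul_one (tangentCoord x v)).symm

theorem HermitianMetric.normSq_eq (g : HermitianMetric M) (x : M)
    (v : TangentSpace 𝓘(ℂ, ℂ) x) :
    g.normSq x v = ‖tangentCoord x v‖ ^ 2 * g.normSq x (baseVec x) := by
  rw [← g.normSq_smul, ← tangent_eq_smul_baseVec]

theorem HermitianMetric.normSq_baseVec_pos (g : HermitianMetric M) (x : M) :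
    0 < g.normSq x (baseVec x) := g.pos x _ (baseVec_ne_zero x)

/-- The quotient `g / g'` of two conformal metrics. -/
def HermitianMetric.ratio (g g' : HermitianMetric M) (x : M) : ℝ :=
  g.normSq x (baseVec x) / g'.normSq x (baseVec x)

theorem HermitianMetric.ratio_pos (g g' : HermitianMetric M) (x : M) : 0 < g.ratio g' x :=
  div_pos (g.normSq_baseVec_pos x) (g'.normSq_baseVec_pos x)

theorem HermitianMetric.factor_eq_ratio_mul (g g' : HermitianMetric M) (x₀ : M) (z : ℂ) :
    g.factor x₀ z = g.ratio g' ((chartAt ℂ x₀).symm z) * g'.factor x₀ z := by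
  have := (g'.normSq_baseVec_pos ((chartAt ℂ x₀).symm z)).ne'
  rw [factor, factor, g.normSq_eq, g'.normSq_eq, ratio]
  field_simp

theorem HermitianMetric.continuousOn_factor (g : HermitianMetric M) (x₀ : M) :
    ContinuousOn (g.factor x₀) (chartAt ℂ x₀).target := (g.smooth x₀).continuousOn

variable [IsManifold 𝓘(ℂ, ℂ) ω M]

instance : IsManifold 𝓘(ℂ, ℂ) 1 M := IsManifold.of_le (n := ω) (by simp)

theorem mdifferentiableAt_chart_symm (x₀ : M) {z : ℂ} (hz : z ∈ (chartAt ℂ x₀).target) :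
    MDifferentiableAt 𝓘(ℂ, ℂ) 𝓘(ℂ, ℂ) (chartAt ℂ x₀).symm z :=
  mdifferentiableAt_atlas_symm (chart_mem_atlas ℂ x₀) hz

theorem coordVec_ne_zero (x₀ : M) {z : ℂ} (hz : z ∈ (chartAt ℂ x₀).target) :
    coordVec x₀ z ≠ 0 := by
  intro h
  have h1 := (mdifferentiable_chart (I := 𝓘(ℂ, ℂ)) x₀).comp_symm_deriv hz
  have h2 := congrArg (fun L => L (1 : ℂ)) h1
  have h3 : mfderiv 𝓘(ℂ, ℂ) 𝓘(ℂ, ℂ) (chartAt ℂ x₀).symm z (1 : ℂ) = 0 := h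
  have h4 : mfderiv 𝓘(ℂ, ℂ) 𝓘(ℂ, ℂ) (chartAt ℂ x₀) ((chartAt ℂ x₀).symm z)
      (mfderiv 𝓘(ℂ, ℂ) 𝓘(ℂ, ℂ) (chartAt ℂ x₀).symm z (1 : ℂ)) = (1 : ℂ) := h2
  rw [h3, map_zero] at h4
  exact zero_ne_one (α := ℂ) h4

theorem HermitianMetric.factor_pos (g : HermitianMetric M) (x₀ : M) {z : ℂ}
    (hz : z ∈ (chartAt ℂ x₀).target) : 0 < g.factor x₀ z :=
  g.pos _ _ (coordVec_ne_zero x₀ hz)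

/-- The ratio does not depend on the tangent vector, so near `x₀` it is the quotient of the
conformal factors in one fixed chart. The vectors `baseVec` themselves change chart from point to
point. -/
theorem HermitianMetric.continuous_ratio (g g' : HermitianMetric M) :
    Continuous (g.ratio g') := by
  refine continuous_iff_continuousAt.2 fun x₀ => ?_
  have hmem := mem_chart_target ℂ x₀
  have h1 : ContinuousAt (fun z => g.factor x₀ z / g'.factor x₀ z) (chartAt ℂ x₀ x₀) :=
    ((g.continuousOn_factor x₀).continuousAt ((chartAt ℂ x₀).open_target.mem_nhds hmem)).div
      ((g'.continuousOn_factor x₀).continuousAt ((chartAt ℂ x₀).open_target.mem_nhds hmem))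
      (g'.factor_pos x₀ hmem).ne'
  have h2 := ContinuousAt.comp (f := chartAt ℂ x₀) (x := x₀) h1
    ((chartAt ℂ x₀).continuousAt (mem_chart_source ℂ x₀))
  refine h2.congr ?_
  filter_upwards [(chartAt ℂ x₀).open_source.mem_nhds (mem_chart_source ℂ x₀)] with y hy
  have h3 := (chartAt ℂ x₀).map_source hy
  have h4 := g.factor_eq_ratio_mul g' x₀ (chartAt ℂ x₀ y)
  rw [(chartAt ℂ x₀).left_inv hy] at h4
  simp only [Function.comp]
  rw [h4, mul_div_cancel_right₀ _ (g'.factor_pos x₀ h3).ne']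

/-- The factor `‖τ'‖²` is the real Jacobian of the holomorphic transition map `τ`, which makes the
chart areas agree on overlaps. -/
theorem HermitianMetric.factor_transition (g : HermitianMetric M) (x y : M) {z : ℂ}
    (hz : z ∈ (chartAt ℂ y).target) (hzx : (chartAt ℂ y).symm z ∈ (chartAt ℂ x).source) :
    DifferentiableAt ℂ (fun w => chartAt ℂ x ((chartAt ℂ y).symm w)) z ∧
    g.factor y z = ‖deriv (fun w => chartAt ℂ x ((chartAt ℂ y).symm w)) z‖ ^ 2 *
      g.factor x (chartAt ℂ x ((chartAt ℂ y).symm z)) := by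
  set τ : ℂ → ℂ := fun w => chartAt ℂ x ((chartAt ℂ y).symm w) with hτ
  have hτd : MDifferentiableAt 𝓘(ℂ, ℂ) 𝓘(ℂ, ℂ) τ z :=
    (mdifferentiableAt_atlas (chart_mem_atlas ℂ x) hzx).comp z (mdifferentiableAt_chart_symm y hz)
  have hτd' : DifferentiableAt ℂ τ z := mdifferentiableAt_iff_differentiableAt.1 hτd
  refine ⟨hτd', ?_⟩
  have hτz : τ z ∈ (chartAt ℂ x).target := (chartAt ℂ x).map_source hzx
  have hev : (chartAt ℂ y).symm =ᶠ[𝓝 z] (chartAt ℂ x).symm ∘ τ := by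
    have h1 : ∀ᶠ w in 𝓝 z, (chartAt ℂ y).symm w ∈ (chartAt ℂ x).source :=
      ((chartAt ℂ y).continuousAt_symm hz).eventually ((chartAt ℂ x).open_source.mem_nhds hzx)
    filter_upwards [h1] with w hw
    exact ((chartAt ℂ x).left_inv hw).symm
  have hpt : (chartAt ℂ x).symm (τ z) = (chartAt ℂ y).symm z := (chartAt ℂ x).left_inv hzx
  have hd : mfderiv 𝓘(ℂ, ℂ) 𝓘(ℂ, ℂ) (chartAt ℂ y).symm z =
      mfderiv 𝓘(ℂ, ℂ) 𝓘(ℂ, ℂ) ((chartAt ℂ x).symm ∘ τ) z := hev.mfderiv_eq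
  have hc := mfderiv_comp z (mdifferentiableAt_chart_symm x hτz) hτd
  -- The base points of the two vectors are equal but not by definition, so the vectors are compared
  -- through their coordinates in `ℂ`.
  have hv : tangentCoord _ (coordVec y z) = deriv τ z * tangentCoord _ (coordVec x (τ z)) := by
    have h1 : tangentCoord _ (coordVec y z) =
        tangentCoord _ (mfderiv 𝓘(ℂ, ℂ) 𝓘(ℂ, ℂ) (chartAt ℂ x).symm (τ z)
          (mfderiv 𝓘(ℂ, ℂ) 𝓘(ℂ, ℂ) τ z (1 : ℂ))) :=
      congrArg (fun L : ℂ →L[ℂ] ℂ => L 1) (hd.trans hc)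
    have h2 : mfderiv 𝓘(ℂ, ℂ) 𝓘(ℂ, ℂ) τ z (1 : ℂ) = deriv τ z • (1 : ℂ) := by
      rw [mfderiv_eq_fderiv]
      exact (mul_one (deriv τ z)).symm
    rw [h1, h2]
    exact (mfderiv 𝓘(ℂ, ℂ) 𝓘(ℂ, ℂ) (chartAt ℂ x).symm (τ z)).map_smul (deriv τ z) (1 : ℂ)
  have hbase : g.normSq ((chartAt ℂ x).symm (τ z)) (baseVec _) =
      g.normSq ((chartAt ℂ y).symm z) (baseVec _) := by rw [hpt]
  rw [factor, factor, g.normSq_eq, g.normSq_eq _ (coordVec x (τ z)), hbase, hv, norm_mul]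
  ring

end Metric

/-! ### The area measure -/

theorem withDensity_map_of_aemeasurable {α β : Type*} [MeasurableSpace α] [MeasurableSpace β]
    {μ : Measure α} [SFinite μ] {φ : α → β} (hφ : AEMeasurable φ μ) {f : β → ℝ≥0∞}
    (hf : Measurable f) :
    (μ.map φ).withDensity f = (μ.withDensity fun x => f (φ x)).map φ := by
  ext E hE
  rw [withDensity_apply _ hE, Measure.restrict_map_of_aemeasurable hφ hE,
    lintegral_map' hf.aemeasurable (hφ.mono_measure Measure.restrict_le_self),
    Measure.map_apply_of_aemeasurable (hφ.mono_ac (withDensity_absolutelyContinuous _ _)) hE,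
    withDensity_apply']

theorem withDensity_mono_left {α : Type*} [MeasurableSpace α] {μ ν : Measure α} (h : μ ≤ ν)
    (f : α → ℝ≥0∞) : μ.withDensity f ≤ ν.withDensity f := by
  refine Measure.le_iff.2 fun s hs => ?_
  rw [withDensity_apply _ hs, withDensity_apply _ hs]
  exact lintegral_mono' (Measure.restrict_mono le_rfl h) le_rfl

/-- A density with values in `(0, ∞)` acts on measures as an order isomorphism, with inverse given
by `f⁻¹`, and therefore preserves suprema. -/
theorem withDensity_iSup {α ι : Type*} [MeasurableSpace α] (μ : ι → Measure α) {f : α → ℝ≥0∞}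
    (hf : Measurable f) (h0 : ∀ x, f x ≠ 0) (htop : ∀ x, f x ≠ ⊤) :
    (⨆ i, μ i).withDensity f = ⨆ i, (μ i).withDensity f := by
  apply le_antisymm
  · have h1 : (⨆ i, μ i) ≤ (⨆ i, (μ i).withDensity f).withDensity f⁻¹ := by
      refine iSup_le fun i => ?_
      calc μ i = ((μ i).withDensity f).withDensity f⁻¹ :=
            (withDensity_inv_same hf (ae_of_all _ h0) (ae_of_all _ htop)).symm
        _ ≤ _ := withDensity_mono_left (le_iSup (fun i => (μ i).withDensity f) i) _
    refine (withDensity_mono_left h1 f).trans_eq ?_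
    have h2 := withDensity_inv_same (μ := ⨆ i, (μ i).withDensity f) (f := f⁻¹) hf.inv
      (ae_of_all _ fun x => by simpa using htop x) (ae_of_all _ fun x => by simpa using h0 x)
    simpa only [Pi.inv_apply, inv_inv] using h2
  · exact iSup_le fun i => withDensity_mono_left (le_iSup _ i) f

/-- The measure `ν` plus the supremum restricted to `Uᶜ` is an upper bound of the family. This
localizes the area measure, which is defined as a supremum. -/
theorem iSup_measure_restrict_le {α ι : Type*} [MeasurableSpace α] (μ : ι → Measure α)
    (ν : Measure α) {U : Set α} (hU : MeasurableSet U) (h : ∀ i, (μ i).restrict U ≤ ν) :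
    (⨆ i, μ i).restrict U ≤ ν := by
  have h1 : (⨆ i, μ i) ≤ ν + (⨆ i, μ i).restrict Uᶜ := by
    refine iSup_le fun i => ?_
    rw [← Measure.restrict_add_restrict_compl (μ := μ i) hU]
    exact add_le_add (h i) (Measure.restrict_mono le_rfl (le_iSup _ i))
  refine (Measure.restrict_mono le_rfl h1).trans ?_
  rw [Measure.restrict_add, Measure.restrict_restrict hU, Set.inter_compl_self,
    Measure.restrict_empty, add_zero]
  exact Measure.restrict_le_self

section Area

variable {M : Type*} [TopologicalSpace M] [ChartedSpace ℂ M] [MeasurableSpace M] [BorelSpace M]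

theorem aemeasurable_chart_symm (x₀ : M) :
    AEMeasurable (chartAt ℂ x₀).symm (volume.restrict (chartAt ℂ x₀).target) :=
  (chartAt ℂ x₀).continuousOn_symm.aemeasurable (chartAt ℂ x₀).open_target.measurableSet

theorem measurableSet_target_inter_preimage (x₀ : M) {E : Set M} (hE : MeasurableSet E) :
    MeasurableSet ((chartAt ℂ x₀).target ∩ (chartAt ℂ x₀).symm ⁻¹' E) := by
  have h := (continuousOn_iff_continuous_domRestrict.1 (chartAt ℂ x₀).continuousOn_symm).measurable hE
  have h2 := (chartAt ℂ x₀).open_target.measurableSet.subtype_image h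
  convert h2 using 1
  ext z
  simp [and_comm]

theorem HermitianMetric.chartArea_apply (g : HermitianMetric M) (x₀ : M) {E : Set M}
    (hE : MeasurableSet E) :
    g.chartArea x₀ E = ∫⁻ z in (chartAt ℂ x₀).target ∩ (chartAt ℂ x₀).symm ⁻¹' E,
      ENNReal.ofReal (g.factor x₀ z) := by
  rw [chartArea, Measure.map_apply_of_aemeasurable
    ((aemeasurable_chart_symm x₀).mono_ac (withDensity_absolutelyContinuous _ _)) hE,
    withDensity_apply', Measure.restrict_restrict' (chartAt ℂ x₀).open_target.measurableSet,
    Set.inter_comm]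

theorem HermitianMetric.chartArea_singleton (g : HermitianMetric M) [T1Space M] (x₀ x : M) :
    g.chartArea x₀ {x} = 0 := by
  rw [g.chartArea_apply x₀ (measurableSet_singleton x)]
  refine setLIntegral_measure_zero _ _ (Set.Subsingleton.measure_zero ?_ _)
  rintro z ⟨hz, hzx⟩ w ⟨hw, hwx⟩
  exact (chartAt ℂ x₀).symm.injOn hz hw (hzx.trans hwx.symm)

theorem HermitianMetric.areaMeasure_finite (g : HermitianMetric M) [T1Space M] {Z : Set M}
    (hZ : Z.Finite) : g.areaMeasure Z = 0 := by
  rw [← biUnion_of_singleton Z]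
  refine (measure_biUnion_null_iff hZ.countable).2 fun x _ => ?_
  have h := iSup_measure_restrict_le (fun x₀ => g.chartArea x₀) 0 (measurableSet_singleton x)
    (fun x₀ => by
      rw [Measure.restrict_eq_zero.2 (g.chartArea_singleton x₀ x)])
  exact Measure.restrict_eq_zero.1 (le_bot_iff.1 h)

variable [IsManifold 𝓘(ℂ, ℂ) ω M]

theorem HermitianMetric.chartArea_eq_withDensity (g g' : HermitianMetric M) (x₀ : M) :
    g.chartArea x₀ = (g'.chartArea x₀).withDensity fun x => ENNReal.ofReal (g.ratio g' x) := by
  have hr : Measurable fun x => ENNReal.ofReal (g.ratio g' x) :=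
    (g.continuous_ratio g').measurable.ennreal_ofReal
  have hm := aemeasurable_chart_symm x₀
  have hf : AEMeasurable (fun z => ENNReal.ofReal (g'.factor x₀ z))
      (volume.restrict (chartAt ℂ x₀).target) :=
    ((g'.continuousOn_factor x₀).aemeasurable
      (chartAt ℂ x₀).open_target.measurableSet).ennreal_ofReal
  rw [chartArea, chartArea, withDensity_map_of_aemeasurable
    (hm.mono_ac (withDensity_absolutelyContinuous _ _)) hr,
    ← withDensity_mul₀ (g := fun z => ENNReal.ofReal (g.ratio g' ((chartAt ℂ x₀).symm z))) hf
      (hr.comp_aemeasurable hm)]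
  congr 2
  funext z
  rw [Pi.mul_apply, g.factor_eq_ratio_mul g', mul_comm (g.ratio g' _),
    ENNReal.ofReal_mul' (g.ratio_pos g' _).le]

/-- The relation holds chart by chart with one global density, and this density passes through the
supremum; no partition of the surface is needed. -/
theorem HermitianMetric.areaMeasure_eq_withDensity (g g' : HermitianMetric M) :
    g.areaMeasure = g'.areaMeasure.withDensity fun x => ENNReal.ofReal (g.ratio g' x) := by
  rw [areaMeasure, areaMeasure, withDensity_iSup _ (g.continuous_ratio g').measurable.ennreal_ofReal
    (fun x => by simpa using g.ratio_pos g' x) (fun x => ENNReal.ofReal_ne_top)]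
  exact iSup_congr fun x₀ => g.chartArea_eq_withDensity g' x₀

theorem abs_det_restrictScalars_toSpanSingleton (c : ℂ) :
    |((ContinuousLinearMap.toSpanSingleton ℂ c).restrictScalars ℝ : ℂ →L[ℝ] ℂ).det| = ‖c‖ ^ 2 := by
  have h : |((ContinuousLinearMap.toSpanSingleton ℂ c).restrictScalars ℝ : ℂ →L[ℝ] ℂ).det| =
      |Algebra.norm ℝ (LinearMap.det ((ContinuousLinearMap.toSpanSingleton ℂ c : ℂ →L[ℂ] ℂ) : ℂ →ₗ[ℂ] ℂ))| := by
    rw [← LinearMap.det_restrictScalars]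
    rfl
  rw [h, Algebra.norm_complex_apply]
  simp [Complex.normSq_eq_norm_sq]

/-- Change of variables along the transition map, which is injective on the overlap. Hence on the
domain of one chart the supremum of all chart areas is controlled by that chart alone. -/
theorem HermitianMetric.chartArea_restrict_le (g : HermitianMetric M) (x y : M) :
    (g.chartArea y).restrict (chartAt ℂ x).source ≤ g.chartArea x := by
  have hsrc := (chartAt ℂ x).open_source.measurableSet
  refine Measure.le_iff.2 fun E hE => ?_
  rw [Measure.restrict_apply hE, g.chartArea_apply y (hE.inter hsrc), g.chartArea_apply x hE]
  set T := (chartAt ℂ y).target ∩ (chartAt ℂ y).symm ⁻¹' (E ∩ (chartAt ℂ x).source)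
  have hT : MeasurableSet T := measurableSet_target_inter_preimage y (hE.inter hsrc)
  let τ : ℂ → ℂ := fun w => chartAt ℂ x ((chartAt ℂ y).symm w)
  have hinj : Set.InjOn τ T := by
    rintro z ⟨hz, hz'⟩ w ⟨hw, hw'⟩ h
    exact (chartAt ℂ y).symm.injOn hz hw ((chartAt ℂ x).injOn hz'.2 hw'.2 h)
  have hd : ∀ z ∈ T, HasFDerivWithinAt τ
      ((ContinuousLinearMap.toSpanSingleton ℂ (deriv τ z)).restrictScalars ℝ) T z := fun z hz =>
    ((g.factor_transition x y hz.1 hz.2.2).1.hasDerivAt.hasFDerivAt.restrictScalars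
      ℝ).hasFDerivWithinAt
  have h1 := lintegral_image_eq_lintegral_abs_det_fderiv_mul volume hT hd hinj
    (fun z => ENNReal.ofReal (g.factor x z))
  have h2 : ∫⁻ z in T, ENNReal.ofReal (g.factor y z) =
      ∫⁻ z in τ '' T, ENNReal.ofReal (g.factor x z) := by
    rw [h1]
    refine setLIntegral_congr_fun hT fun z hz => ?_
    simp only [abs_det_restrictScalars_toSpanSingleton]
    rw [(g.factor_transition x y hz.1 hz.2.2).2, ENNReal.ofReal_mul (by positivity)]
  rw [h2]
  refine lintegral_mono_set ?_
  rintro _ ⟨z, hz, rfl⟩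
  refine ⟨(chartAt ℂ x).map_source hz.2.2, ?_⟩
  change (chartAt ℂ x).symm (chartAt ℂ x ((chartAt ℂ y).symm z)) ∈ E
  rw [(chartAt ℂ x).left_inv hz.2.2]
  exact hz.2.1

theorem HermitianMetric.area_lt_top [CompactSpace M] (g : HermitianMetric M) : g.area < ⊤ := by
  refine isCompact_univ.measure_lt_top_of_nhdsWithin fun x _ => ?_
  rw [nhdsWithin_univ]
  have hx := mem_chart_target ℂ x
  have hc : ContinuousAt (g.factor x) (chartAt ℂ x x) :=
    (g.continuousOn_factor x).continuousAt ((chartAt ℂ x).open_target.mem_nhds hx)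
  have h1 : ∀ᶠ z in 𝓝 (chartAt ℂ x x), g.factor x z < g.factor x (chartAt ℂ x x) + 1 :=
    hc.eventually_lt continuousAt_const (by linarith)
  obtain ⟨r, hr, hball⟩ := Metric.eventually_nhds_iff_ball.1 h1
  let V : Set M := (chartAt ℂ x).source ∩ chartAt ℂ x ⁻¹' Metric.ball (chartAt ℂ x x) r
  have hVo : IsOpen V := (chartAt ℂ x).isOpen_inter_preimage Metric.isOpen_ball
  have hV : V ∈ 𝓝 x := hVo.mem_nhds ⟨mem_chart_source ℂ x, Metric.mem_ball_self hr⟩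
  refine ⟨V, hV, ?_⟩
  have h2 := iSup_measure_restrict_le (fun y => g.chartArea y) (g.chartArea x)
    (chartAt ℂ x).open_source.measurableSet (fun y => g.chartArea_restrict_le x y)
  have h3 : g.areaMeasure V ≤ g.chartArea x V := by
    calc g.areaMeasure V = g.areaMeasure.restrict (chartAt ℂ x).source V := by
          rw [Measure.restrict_apply hVo.measurableSet, Set.inter_eq_left.2 inter_subset_left]
      _ ≤ _ := h2 V
  refine h3.trans_lt ?_
  rw [g.chartArea_apply x hVo.measurableSet]
  have h4 : (chartAt ℂ x).target ∩ (chartAt ℂ x).symm ⁻¹' V ⊆ Metric.ball (chartAt ℂ x x) r := by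
    rintro z ⟨hz, hz2⟩
    have := hz2.2
    rwa [Set.mem_preimage, (chartAt ℂ x).right_inv hz] at this
  calc _ ≤ ∫⁻ z in Metric.ball (chartAt ℂ x x) r, ENNReal.ofReal (g.factor x z) :=
        lintegral_mono_set h4
    _ ≤ ∫⁻ _ in Metric.ball (chartAt ℂ x x) r, ENNReal.ofReal (g.factor x (chartAt ℂ x x) + 1) :=
        setLIntegral_mono measurable_const fun z hz => ENNReal.ofReal_le_ofReal (hball z hz).le
    _ < ⊤ := by
        rw [setLIntegral_const]
        exact ENNReal.mul_lt_top ENNReal.ofReal_lt_top measure_ball_lt_top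

/-- Together with finiteness, this permits division by `Area^{1/2}` in `[0, ∞]`. -/
theorem HermitianMetric.area_ne_zero [Nonempty M] (g : HermitianMetric M) : g.area ≠ 0 := by
  obtain ⟨x⟩ := ‹Nonempty M›
  have h1 : g.chartArea x univ ≤ g.area := le_iSup (fun x => g.chartArea x) x univ
  refine fun h0 => absurd (le_zero_iff.1 (h0 ▸ h1)) ?_
  rw [g.chartArea_apply x MeasurableSet.univ, preimage_univ, inter_univ]
  intro h2
  have ho := (chartAt ℂ x).open_target
  have hm : AEMeasurable (fun z => ENNReal.ofReal (g.factor x z))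
      (volume.restrict (chartAt ℂ x).target) :=
    ((g.continuousOn_factor x).aemeasurable ho.measurableSet).ennreal_ofReal
  rw [lintegral_eq_zero_iff' hm, Filter.EventuallyEq, ae_restrict_iff' ho.measurableSet] at h2
  have h3 : volume (chartAt ℂ x).target = 0 := by
    refine measure_mono_null (fun z hz => ?_) (ae_iff.1 h2)
    simpa [hz] using g.factor_pos x hz
  exact (ho.measure_pos volume ⟨_, mem_chart_target ℂ x⟩).ne' h3

end Area

/-! ### The `∂̄`-operator in coordinates -/

theorem wbar_comp_holomorphic {E : Type*} [NormedAddCommGroup E] [NormedSpace ℂ E] {G : ℂ → E}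
    {τ : ℂ → ℂ} {z : ℂ} (hτ : DifferentiableAt ℂ τ z) (hG : DifferentiableAt ℝ G (τ z)) :
    wbar (fun w => G (τ w)) z = (starRingEnd ℂ) (deriv τ z) • wbar G (τ z) := by
  have h1 : HasFDerivAt τ ((ContinuousLinearMap.toSpanSingleton ℂ (deriv τ z)).restrictScalars ℝ) z :=
    hτ.hasDerivAt.hasFDerivAt.restrictScalars ℝ
  rw [HasFDerivAt.wbar_eq (f := fun w => G (τ w)) (hG.hasFDerivAt.comp z h1)]
  simp only [ContinuousLinearMap.comp_apply, ContinuousLinearMap.coe_restrictScalars',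
    ContinuousLinearMap.toSpanSingleton_apply, fderiv_eq_wirtinger, smul_eq_mul, one_mul, map_mul,
    Complex.conj_I]
  match_scalars
  · linear_combination (deriv τ z / 2) * Complex.I_mul_I
  · linear_combination (-(starRingEnd ℂ) (deriv τ z) / 2) * Complex.I_mul_I

section Surface

variable {M : Type*} [TopologicalSpace M] [ChartedSpace ℂ M]
  {E : Type*} [NormedAddCommGroup E] [NormedSpace ℂ E]

/-- For continuous `F` the two notions of differentiability coincide, and both derivatives are `0`
by convention when it fails; hence no differentiability is assumed. -/
theorem realDiff_eq_fderiv {F : M → E} {x : M} (hF : ContinuousAt F x)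
    (v : TangentSpace 𝓘(ℂ, ℂ) x) :
    realDiff F x v = fderiv ℝ (fun z => F ((chartAt ℂ x).symm z)) (chartAt ℂ x x)
      (tangentCoord x v) := by
  have h1 : (MDifferentiableAt 𝓘(ℝ, ℂ) 𝓘(ℝ, E) F x) ↔
      DifferentiableAt ℝ (fun z => F ((chartAt ℂ x).symm z)) (chartAt ℂ x x) := by
    rw [mdifferentiableAt_iff]
    simp only [hF, true_and]
    simp [DifferentiableWithinAt, DifferentiableAt, writtenInExtChartAt, hasFDerivWithinAt_univ]
    rfl
  by_cases hd : MDifferentiableAt 𝓘(ℝ, ℂ) 𝓘(ℝ, E) F x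
  · simp only [realDiff, mfderiv, hd]
    simp [writtenInExtChartAt, tangentCoord]
    rfl
  · rw [realDiff, mfderiv_zero_of_not_mdifferentiableAt hd,
      fderiv_zero_of_not_differentiableAt (fun h => hd (h1.2 h))]
    rfl

theorem dbar_eq_wbar {F : M → E} {x : M} (hF : ContinuousAt F x) (v : TangentSpace 𝓘(ℂ, ℂ) x) :
    dbar F x v = (starRingEnd ℂ) (tangentCoord x v) •
      wbar (fun z => F ((chartAt ℂ x).symm z)) (chartAt ℂ x x) := by
  have hI : tangentCoord x (Complex.I • v) = Complex.I * tangentCoord x v := rfl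
  rw [dbar, realDiff_eq_fderiv hF, realDiff_eq_fderiv hF, fderiv_eq_wirtinger, fderiv_eq_wirtinger,
    hI, map_mul, Complex.conj_I]
  match_scalars
  · linear_combination (tangentCoord x v / 2) * Complex.I_mul_I
  · linear_combination (-(starRingEnd ℂ) (tangentCoord x v) / 2) * Complex.I_mul_I

theorem dbar_smul {F : M → E} {x : M} (hF : ContinuousAt F x) (c : ℂ)
    (v : TangentSpace 𝓘(ℂ, ℂ) x) : dbar F x (c • v) = (starRingEnd ℂ) c • dbar F x v := by
  have hc : tangentCoord x (c • v) = c * tangentCoord x v := rfl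
  rw [dbar_eq_wbar hF, dbar_eq_wbar hF, hc, map_mul, mul_smul]

theorem dbar_baseVec {F : M → E} {x : M} (hF : ContinuousAt F x) :
    dbar F x (baseVec x) = wbar (fun z => F ((chartAt ℂ x).symm z)) (chartAt ℂ x x) := by
  rw [dbar_eq_wbar hF]
  have : tangentCoord x (baseVec x) = 1 := rfl
  rw [this, map_one, one_smul]

theorem eventually_comp_chart_symm {x : M} {p : M → Prop} (h : ∀ᶠ y in 𝓝 x, p y) :
    ∀ᶠ z in 𝓝 (chartAt ℂ x x), p ((chartAt ℂ x).symm z) := by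
  have h1 := (chartAt ℂ x).continuousAt_symm (mem_chart_target ℂ x)
  rw [ContinuousAt, (chartAt ℂ x).left_inv (mem_chart_source ℂ x)] at h1
  exact h1.eventually h

theorem dbar_congr {F F' : M → E} {x : M} (hF : ContinuousAt F x) (h : F =ᶠ[𝓝 x] F')
    (v : TangentSpace 𝓘(ℂ, ℂ) x) : dbar F x v = dbar F' x v := by
  rw [dbar_eq_wbar hF, dbar_eq_wbar (hF.congr h),
    wbar_congr (eventually_comp_chart_symm (p := fun y => F y = F' y) h)]

theorem dbar_holomorphic_smul {φ : M → ℂ} {F : M → E} {x : M}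
    (hφ : MDifferentiableAt 𝓘(ℂ, ℂ) 𝓘(ℂ, ℂ) φ x) (hF : ContinuousAt F x)
    (hF' : DifferentiableAt ℝ (fun z => F ((chartAt ℂ x).symm z)) (chartAt ℂ x x))
    (v : TangentSpace 𝓘(ℂ, ℂ) x) :
    dbar (fun y => φ y • F y) x v = φ x • dbar F x v := by
  have h1 : DifferentiableAt ℂ (fun z => φ ((chartAt ℂ x).symm z)) (chartAt ℂ x x) := by
    have h2 := ((mdifferentiableAt_iff _ _).1 hφ).2
    simp only [modelWithCornersSelf_coe, range_id, differentiableWithinAt_univ] at h2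
    exact h2
  rw [dbar_eq_wbar (F := fun y => φ y • F y) (hφ.continuousAt.smul hF), dbar_eq_wbar hF, wbar_smul h1 hF',
    (chartAt ℂ x).left_inv (mem_chart_source ℂ x), smul_comm]

variable [IsManifold 𝓘(ℂ, ℂ) ω M]

theorem tangentCoord_coordVec (x₀ : M) {z : ℂ} (hz : z ∈ (chartAt ℂ x₀).target) :
    tangentCoord _ (coordVec x₀ z) =
      deriv (fun w => chartAt ℂ ((chartAt ℂ x₀).symm z) ((chartAt ℂ x₀).symm w)) z := by
  have h := mdifferentiableAt_chart_symm x₀ hz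
  simp only [tangentCoord, coordVec, mfderiv, h]
  simp [writtenInExtChartAt, Function.comp_def]
  rfl

/-- The operator `dbar` at `x` is computed in the preferred chart at `x`; this transfers regularity
and `∂̄` from a fixed chart at `x₀`. -/
theorem differentiableAt_chart_symm_of_chart {F : M → E} {x₀ x : M} (hx : x ∈ (chartAt ℂ x₀).source)
    (hF : DifferentiableAt ℝ (fun w => F ((chartAt ℂ x₀).symm w)) (chartAt ℂ x₀ x)) :
    ContinuousAt F x ∧
    DifferentiableAt ℝ (fun w => F ((chartAt ℂ x).symm w)) (chartAt ℂ x x) ∧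
    wbar (fun w => F ((chartAt ℂ x).symm w)) (chartAt ℂ x x) =
      (starRingEnd ℂ) (deriv (fun w => chartAt ℂ x₀ ((chartAt ℂ x).symm w)) (chartAt ℂ x x)) •
        wbar (fun w => F ((chartAt ℂ x₀).symm w)) (chartAt ℂ x₀ x) := by
  set τ : ℂ → ℂ := fun w => chartAt ℂ x₀ ((chartAt ℂ x).symm w) with hτdef
  have hxx := (chartAt ℂ x).left_inv (mem_chart_source ℂ x)
  have hτz : τ (chartAt ℂ x x) = chartAt ℂ x₀ x := by simp only [hτdef, hxx]
  have hev0 : F =ᶠ[𝓝 x] fun y => F ((chartAt ℂ x₀).symm (chartAt ℂ x₀ y)) := by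
    filter_upwards [(chartAt ℂ x₀).open_source.mem_nhds hx] with y hy
    rw [(chartAt ℂ x₀).left_inv hy]
  have hev := eventually_comp_chart_symm hev0
  have hτ : DifferentiableAt ℂ τ (chartAt ℂ x x) := by
    refine mdifferentiableAt_iff_differentiableAt.1 ?_
    refine MDifferentiableAt.comp (I' := 𝓘(ℂ, ℂ)) (chartAt ℂ x x) ?_
      (mdifferentiableAt_chart_symm x (mem_chart_target ℂ x))
    rw [hxx]
    exact mdifferentiableAt_atlas (chart_mem_atlas ℂ x₀) hx
  have hF' : DifferentiableAt ℝ (fun w => F ((chartAt ℂ x₀).symm w)) (τ (chartAt ℂ x x)) := by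
    rwa [hτz]
  refine ⟨?_, ?_, ?_⟩
  · exact (ContinuousAt.comp (f := chartAt ℂ x₀) (x := x) hF.continuousAt
      ((chartAt ℂ x₀).continuousAt hx)).congr hev0.symm
  · refine (Filter.EventuallyEq.differentiableAt_iff hev).2 ?_
    exact hF'.comp (chartAt ℂ x x) (hτ.restrictScalars ℝ)
  · rw [wbar_congr hev, wbar_comp_holomorphic hτ hF', hτz]

/-- The derivatives of the two mutually inverse transition maps have product `1`, so the conjugate
factors cancel. -/
theorem dbar_coordVec {F : M → E} {x₀ : M} {z : ℂ} (hz : z ∈ (chartAt ℂ x₀).target)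
    (hF : DifferentiableAt ℝ (fun w => F ((chartAt ℂ x₀).symm w)) z) :
    dbar F ((chartAt ℂ x₀).symm z) (coordVec x₀ z) =
      wbar (fun w => F ((chartAt ℂ x₀).symm w)) z := by
  set x := (chartAt ℂ x₀).symm z with hxdef
  have hx : x ∈ (chartAt ℂ x₀).source := (chartAt ℂ x₀).map_target hz
  have hzx : chartAt ℂ x₀ x = z := (chartAt ℂ x₀).right_inv hz
  rw [← hzx] at hF
  obtain ⟨h1, h2, h3⟩ := differentiableAt_chart_symm_of_chart hx hF
  rw [dbar_eq_wbar h1, h3, hzx, tangentCoord_coordVec x₀ hz, smul_smul, ← map_mul]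
  suffices h : deriv (fun w => chartAt ℂ x ((chartAt ℂ x₀).symm w)) z *
      deriv (fun w => chartAt ℂ x₀ ((chartAt ℂ x).symm w)) (chartAt ℂ x x) = 1 by
    rw [h, map_one, one_smul]
  have hxx := (chartAt ℂ x).left_inv (mem_chart_source ℂ x)
  have ha : DifferentiableAt ℂ (fun w => chartAt ℂ x ((chartAt ℂ x₀).symm w)) z :=
    mdifferentiableAt_iff_differentiableAt.1 (MDifferentiableAt.comp (I' := 𝓘(ℂ, ℂ)) z
      (mdifferentiableAt_atlas (chart_mem_atlas ℂ x) (mem_chart_source ℂ x))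
      (mdifferentiableAt_chart_symm x₀ hz))
  have hb : DifferentiableAt ℂ (fun w => chartAt ℂ x₀ ((chartAt ℂ x).symm w)) (chartAt ℂ x x) := by
    refine mdifferentiableAt_iff_differentiableAt.1 (MDifferentiableAt.comp (I' := 𝓘(ℂ, ℂ)) _ ?_
      (mdifferentiableAt_chart_symm x (mem_chart_target ℂ x)))
    rw [hxx]
    exact mdifferentiableAt_atlas (chart_mem_atlas ℂ x₀) hx
  have hc := HasDerivAt.comp (h₂ := fun w => chartAt ℂ x₀ ((chartAt ℂ x).symm w))
    (h := fun w => chartAt ℂ x ((chartAt ℂ x₀).symm w)) z hb.hasDerivAt ha.hasDerivAt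
  rw [mul_comm]
  refine hc.unique ((hasDerivAt_id z).congr_of_eventuallyEq ?_)
  have h4 : ∀ᶠ w in 𝓝 z, (chartAt ℂ x₀).symm w ∈ (chartAt ℂ x).source :=
    ((chartAt ℂ x₀).continuousAt_symm hz).eventually
      ((chartAt ℂ x).open_source.mem_nhds (mem_chart_source ℂ x))
  filter_upwards [h4, (chartAt ℂ x₀).open_target.mem_nhds hz] with w hw hw2
  simp only [Function.comp, id]
  rw [(chartAt ℂ x).left_inv hw, (chartAt ℂ x₀).right_inv hw2]

end Surface

/-! ### Local frames and the Dirac equation -/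

/-- A functional `L` with `L s ≠ 0` gives a bilinear form sending `s ⊗ s` to `(L s)² ≠ 0`. -/
theorem tmul_self_ne_zero {V : Type*} [AddCommGroup V] [Module ℂ V] {s : V} (hs : s ≠ 0) :
    s ⊗ₜ[ℂ] s ≠ 0 := by
  obtain ⟨L, hL⟩ := Module.Projective.exists_dual_ne_zero ℂ hs
  intro h
  have h1 := congrArg (TensorProduct.lift ((LinearMap.mul ℂ ℂ).compl₁₂ L L)) h
  rw [map_zero, TensorProduct.lift.tmul] at h1
  exact mul_ne_zero hL hL h1

section Frame

variable {M : Type*} [TopologicalSpace M] [ChartedSpace ℂ M]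
  {S : M → Type*} [∀ x, AddCommGroup (S x)] [∀ x, Module ℂ (S x)] [∀ x, TopologicalSpace (S x)]
  [TopologicalSpace (TotalSpace ℂ S)] [FiberBundle ℂ S]

variable (S) in
/-- The local frame of `S` given by the preferred trivialization at `x₀`. -/
def frameAt (x₀ y : M) : S y := (trivializationAt ℂ S x₀).symm y 1

theorem frameAt_self (x : M) : frameAt S x x = frameVec S x := rfl

variable [VectorBundle ℂ ℂ S]

theorem coeff_smul (x : M) {y : M} (hy : y ∈ (trivializationAt ℂ S x).baseSet)
    (s t : ∀ x, S x) (c : ℂ) (h : s y = c • t y) : coeff s x y = c * coeff t x y := by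
  have h1 := ((trivializationAt ℂ S x).linear ℂ hy).map_smul c (t y)
  rw [coeff, h]
  exact h1

theorem coeff_frameAt (x₀ : M) {y : M} (hy : y ∈ (trivializationAt ℂ S x₀).baseSet) :
    coeff (frameAt S x₀) x₀ y = 1 := by
  rw [coeff, frameAt, Trivialization.apply_mk_symm _ hy]

theorem eq_coeff_smul_frameAt (x₀ : M) {y : M} (hy : y ∈ (trivializationAt ℂ S x₀).baseSet)
    (s : ∀ x, S x) : s y = coeff s x₀ y • frameAt S x₀ y := by
  have h1 := (trivializationAt ℂ S x₀).symm_apply_apply_mk hy (s y)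
  have h2 := ((trivializationAt ℂ S x₀).symmₗ ℂ y).map_smul (coeff s x₀ y) (1 : ℂ)
  rw [(trivializationAt ℂ S x₀).coe_symmₗ hy, smul_eq_mul, mul_one] at h2
  exact h1.symm.trans h2

theorem frameAt_ne_zero (x₀ : M) {y : M} (hy : y ∈ (trivializationAt ℂ S x₀).baseSet) :
    frameAt S x₀ y ≠ 0 := by
  intro h
  have h1 := coeff_smul x₀ hy (frameAt S x₀) (frameAt S x₀) 0 (by rw [h, smul_zero])
  rw [zero_mul, coeff_frameAt x₀ hy] at h1
  exact one_ne_zero h1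

theorem SpinStructure.sq_smul (σ : SpinStructure S) (x : M) (c : ℂ) (s : S x) :
    σ.sq x (c • s) = c ^ 2 • σ.sq x s := by
  rw [sq, sq, TensorProduct.smul_tmul_smul, map_smul, pow_two]

theorem SpinStructure.sq_apply_ne_zero (σ : SpinStructure S) (x : M) {s : S x} (hs : s ≠ 0)
    {v : TangentSpace 𝓘(ℂ, ℂ) x} (hv : v ≠ 0) : σ.sq x s v ≠ 0 := by
  intro h
  apply tmul_self_ne_zero hs
  apply (σ.iso x).injective
  rw [map_zero]
  ext
  change σ.sq x s (baseVec x) = 0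
  rw [tangent_eq_smul_baseVec x v, map_smul, smul_eq_mul] at h
  exact (mul_eq_zero.1 h).resolve_left hv

theorem SpinStructure.normSq_eq (σ : SpinStructure S) (g : HermitianMetric M) (x : M) (s : S x) :
    σ.normSq g x s = ‖σ.sq x s (baseVec x)‖ / Real.sqrt (g.normSq x (baseVec x)) := rfl

/-- The eigenspinor equation in the frame at the point. -/
theorem IsEigenspinor.dbar_coeff {σ : SpinStructure S} {g : HermitianMetric M} {lam : ℝ}
    {ψ : SpinorField S} (h : IsEigenspinor σ g lam ψ) (y : M) :
    dbar (coeff ψ.1 y) y (baseVec y) = -((lam / 2 : ℂ) * (Real.sqrt (g.normSq y (baseVec y)) *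
      (starRingEnd ℂ) (σ.sq y (frameVec S y) (baseVec y)) / ‖σ.sq y (frameVec S y) (baseVec y)‖) *
      (starRingEnd ℂ) (coeff (fun x => unbar (ψ.2 x)) y y)) ∧
    dbar (coeff (fun x => unbar (ψ.2 x)) y) y (baseVec y) = (lam / 2 : ℂ) *
      (Real.sqrt (g.normSq y (baseVec y)) *
      (starRingEnd ℂ) (σ.sq y (frameVec S y) (baseVec y)) / ‖σ.sq y (frameVec S y) (baseVec y)‖) *
      (starRingEnd ℂ) (coeff ψ.1 y y) := by
  have hy := mem_baseSet_trivializationAt ℂ S y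
  have ht : frameVec S y ≠ 0 := frameAt_ne_zero y hy
  have hq := σ.sq_apply_ne_zero y ht (baseVec_ne_zero y)
  have hG := g.normSq_baseVec_pos y
  have h1 := congrFun (congrArg Prod.fst h.2.2) y
  have h2 := congrArg unbar (congrFun (congrArg Prod.snd h.2.2) y)
  -- The conjugations appear on unfolding the conjugate space, where scalars act through `conj`.
  have e1 : (2 : ℂ) • ((starRingEnd ℂ) ((σ.normSq g y (frameVec S y) : ℂ) *
      (dbar (coeff (fun x => unbar (ψ.2 x)) y) y (baseVec y) /
      (starRingEnd ℂ) (σ.sq y (frameVec S y) (baseVec y)))) • frameVec S y) = (lam : ℂ) • ψ.1 y := h1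
  have e2 : (starRingEnd ℂ) (2 : ℂ) • (-((starRingEnd ℂ) ((σ.normSq g y (frameVec S y) : ℂ) *
      (dbar (coeff ψ.1 y) y (baseVec y) /
      (starRingEnd ℂ) (σ.sq y (frameVec S y) (baseVec y)))) • frameVec S y)) =
      (starRingEnd ℂ) (lam : ℂ) • unbar (ψ.2 y) := h2
  rw [eq_coeff_smul_frameAt y hy ψ.1, frameAt_self, smul_smul, smul_smul] at e1
  rw [eq_coeff_smul_frameAt y hy (fun x => unbar (ψ.2 x)), frameAt_self, smul_smul,
    ← neg_smul, smul_smul] at e2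
  have e1' := congrArg (starRingEnd ℂ) (smul_left_injective ℂ ht e1)
  have e2' := congrArg (starRingEnd ℂ) (smul_left_injective ℂ ht e2)
  set q := σ.sq y (frameVec S y) (baseVec y)
  have hq' : (starRingEnd ℂ) q ≠ 0 := by simpa using hq
  have hqn : (‖q‖ : ℂ) ≠ 0 := by simpa using hq
  have hs : (Real.sqrt (g.normSq y (baseVec y)) : ℂ) ≠ 0 := by
    exact_mod_cast (Real.sqrt_pos.2 hG).ne'
  rw [SpinStructure.normSq_eq] at e1' e2'
  simp only [map_mul, map_neg, Complex.conj_conj, Complex.ofReal_div, Complex.conj_ofReal, map_ofNat] at e1' e2'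
  constructor
  · field_simp at e2' ⊢
    linear_combination -e2'
  · field_simp at e1' ⊢
    linear_combination e1'

/-- Change of frame and of tangent vector in the Dirac equation. -/
theorem dirac_equation_rescale {D h₀ q κ τ c : ℂ} {G : ℝ} (hτ : τ ≠ 0) (hc : c ≠ 0) (hq : q ≠ 0)
    (h : τ * D = κ * (Real.sqrt G * (starRingEnd ℂ) q / ‖q‖) * (starRingEnd ℂ) (τ * h₀)) :
    (starRingEnd ℂ) c * D = κ * (Real.sqrt (‖c‖ ^ 2 * G) * (starRingEnd ℂ) (τ ^ 2 * (c * q)) /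
      ‖τ ^ 2 * (c * q)‖) * (starRingEnd ℂ) h₀ := by
  have hτn : (‖τ‖ : ℂ) ≠ 0 := by simpa using hτ
  have hcn : (‖c‖ : ℂ) ≠ 0 := by simpa using hc
  have hqn : (‖q‖ : ℂ) ≠ 0 := by simpa using hq
  have hτ2 : (‖τ‖ : ℂ) ^ 2 = τ * (starRingEnd ℂ) τ := by
    rw [Complex.mul_conj, Complex.normSq_eq_norm_sq]; norm_cast
  rw [Real.sqrt_mul (by positivity), Real.sqrt_sq (norm_nonneg c)]
  simp only [map_mul, map_pow, norm_mul, norm_pow, Complex.ofReal_mul, Complex.ofReal_pow] at h ⊢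
  have hτ' : (starRingEnd ℂ) τ ≠ 0 := by simpa using hτ
  rw [hτ2]
  field_simp at h ⊢
  linear_combination (starRingEnd ℂ) c * h

variable [IsManifold 𝓘(ℂ, ℂ) ω M] [ContMDiffVectorBundle ω ℂ S 𝓘(ℂ, ℂ)]

theorem isHolomorphicOn_frameAt (x₀ : M) :
    IsHolomorphicOn (frameAt S x₀) (trivializationAt ℂ S x₀).baseSet := by
  rw [IsHolomorphicOn, (trivializationAt ℂ S x₀).contMDiffOn_section_baseSet_iff]
  exact (contMDiffOn_const (c := (1 : ℂ))).congr fun y hy => coeff_frameAt x₀ hy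

theorem mdifferentiableAt_coeff_frameAt (x₀ : M) {y : M}
    (hy : y ∈ (trivializationAt ℂ S x₀).baseSet) :
    MDifferentiableAt 𝓘(ℂ, ℂ) 𝓘(ℂ, ℂ) (coeff (frameAt S x₀) y) y := by
  have h := (isHolomorphicOn_frameAt (S := S) x₀).contMDiffAt
    ((trivializationAt ℂ S x₀).open_baseSet.mem_nhds hy)
  exact ((Bundle.contMDiffAt_section y).1 h).mdifferentiableAt (by simp)

theorem coeff_eventuallyEq (x₀ : M) {y : M} (hy : y ∈ (trivializationAt ℂ S x₀).baseSet)
    (s : ∀ x, S x) :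
    coeff s y =ᶠ[𝓝 y] fun w => coeff (frameAt S x₀) y w • coeff s x₀ w := by
  filter_upwards [(trivializationAt ℂ S x₀).open_baseSet.mem_nhds hy,
    (trivializationAt ℂ S y).open_baseSet.mem_nhds (mem_baseSet_trivializationAt ℂ S y)] with w hw hw'
  rw [coeff_smul y hw' s (frameAt S x₀) _ (eq_coeff_smul_frameAt x₀ hw s), smul_eq_mul, mul_comm]

/-- The square of the local frame at `x₀`, in the coordinate at `x₀`. -/
def SpinStructure.frameSq (σ : SpinStructure S) (x₀ : M) (z : ℂ) : ℂ :=
  σ.sq ((chartAt ℂ x₀).symm z) (frameAt S x₀ ((chartAt ℂ x₀).symm z)) (coordVec x₀ z)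

/-- The coefficient of the Dirac equation in the frame and the coordinate at `x₀`. -/
def diracCoeff (σ : SpinStructure S) (g : HermitianMetric M) (lam : ℝ) (x₀ : M) (z : ℂ) : ℂ :=
  (lam / 2 : ℂ) * (Real.sqrt (g.factor x₀ z) * (starRingEnd ℂ) (σ.frameSq x₀ z) /
    ‖σ.frameSq x₀ z‖)

theorem SpinStructure.frameSq_ne_zero (σ : SpinStructure S) (x₀ : M) {z : ℂ}
    (hz : z ∈ (chartAt ℂ x₀).target)
    (hb : (chartAt ℂ x₀).symm z ∈ (trivializationAt ℂ S x₀).baseSet) : σ.frameSq x₀ z ≠ 0 :=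
  σ.sq_apply_ne_zero _ (frameAt_ne_zero x₀ hb) (coordVec_ne_zero x₀ hz)

/-- The square of the frame is holomorphic without zeros and the conformal factor is positive, so
norm and square root stay smooth. Smoothness is what lets `A · J F` vanish to the order of `F`. -/
theorem contDiffAt_diracCoeff (σ : SpinStructure S) (g : HermitianMetric M) (lam : ℝ) (x₀ : M) :
    ContDiffAt ℝ ∞ (diracCoeff σ g lam x₀) (chartAt ℂ x₀ x₀) := by
  have hz := mem_chart_target ℂ x₀
  have hb : (chartAt ℂ x₀).symm (chartAt ℂ x₀ x₀) ∈ (trivializationAt ℂ S x₀).baseSet := by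
    rw [(chartAt ℂ x₀).left_inv (mem_chart_source ℂ x₀)]
    exact mem_baseSet_trivializationAt ℂ S x₀
  have hopen : IsOpen ((chartAt ℂ x₀).target ∩
      (chartAt ℂ x₀).symm ⁻¹' (trivializationAt ℂ S x₀).baseSet) :=
    (chartAt ℂ x₀).symm.isOpen_inter_preimage (trivializationAt ℂ S x₀).open_baseSet
  have hq : ContDiffAt ℝ ∞ (σ.frameSq x₀) (chartAt ℂ x₀ x₀) := by
    have h1 : DifferentiableOn ℂ (σ.frameSq x₀) ((chartAt ℂ x₀).target ∩
        (chartAt ℂ x₀).symm ⁻¹' (trivializationAt ℂ S x₀).baseSet) :=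
      σ.holomorphic _ (trivializationAt ℂ S x₀).open_baseSet _ _ (isHolomorphicOn_frameAt x₀)
        (isHolomorphicOn_frameAt x₀) x₀
    exact (((h1.contDiffOn hopen).contDiffAt (hopen.mem_nhds ⟨hz, hb⟩)).restrict_scalars ℝ)
  have hG : ContDiffAt ℝ ∞ (g.factor x₀) (chartAt ℂ x₀ x₀) :=
    (g.smooth x₀).contDiffAt ((chartAt ℂ x₀).open_target.mem_nhds hz)
  have hs : ContDiffAt ℝ ∞ (fun z => (Real.sqrt (g.factor x₀ z) : ℂ)) (chartAt ℂ x₀ x₀) :=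
    Complex.ofRealCLM.contDiff.contDiffAt.comp _ (hG.sqrt (g.factor_pos x₀ hz).ne')
  have hc : ContDiffAt ℝ ∞ (fun z => (starRingEnd ℂ) (σ.frameSq x₀ z)) (chartAt ℂ x₀ x₀) :=
    (Complex.conjCLE.contDiff.contDiffAt).comp _ hq
  have hq0 := σ.frameSq_ne_zero x₀ hz hb
  have hn : ContDiffAt ℝ ∞ (fun z => (‖σ.frameSq x₀ z‖ : ℂ)) (chartAt ℂ x₀ x₀) :=
    Complex.ofRealCLM.contDiff.contDiffAt.comp _ (hq.norm ℝ hq0)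
  have h := contDiffAt_const (c := (lam / 2 : ℂ)).mul ((hs.mul hc).mul (hn.inv (by simpa using hq0)))
  refine h.congr_of_eventuallyEq (Filter.Eventually.of_forall fun z => ?_)
  simp only [diracCoeff, Pi.inv_apply, div_eq_mul_inv]

theorem contDiffAt_coeff {s : ∀ x, S x} (hs : IsSmoothSection s) (x₀ : M) :
    ContDiffAt ℝ ∞ (fun z => coeff s x₀ ((chartAt ℂ x₀).symm z)) (chartAt ℂ x₀ x₀) := by
  have h1 := (Bundle.contMDiffAt_section x₀).1 (hs x₀)
  have h2 := (contMDiffAt_iff.1 h1).2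
  simp only [modelWithCornersSelf_coe, range_id, contDiffWithinAt_univ] at h2
  exact h2

/-- The eigenspinor equation in a fixed frame and coordinate. -/
theorem IsEigenspinor.wbar_coeff {σ : SpinStructure S} {g : HermitianMetric M} {lam : ℝ}
    {ψ : SpinorField S} (h : IsEigenspinor σ g lam ψ) (x₀ : M) :
    ∀ᶠ z in 𝓝 (chartAt ℂ x₀ x₀),
      wbar (fun z => coeff ψ.1 x₀ ((chartAt ℂ x₀).symm z)) z = -(diracCoeff σ g lam x₀ z *
        (starRingEnd ℂ) (coeff (fun x => unbar (ψ.2 x)) x₀ ((chartAt ℂ x₀).symm z))) ∧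
      wbar (fun z => coeff (fun x => unbar (ψ.2 x)) x₀ ((chartAt ℂ x₀).symm z)) z =
        diracCoeff σ g lam x₀ z *
        (starRingEnd ℂ) (coeff ψ.1 x₀ ((chartAt ℂ x₀).symm z)) := by
  have hev1 := eventually_comp_chart_symm (p := fun y => y ∈ (trivializationAt ℂ S x₀).baseSet)
    ((trivializationAt ℂ S x₀).open_baseSet.mem_nhds (mem_baseSet_trivializationAt ℂ S x₀))
  filter_upwards [hev1, (chartAt ℂ x₀).open_target.mem_nhds (mem_chart_target ℂ x₀),
    (contDiffAt_coeff h.1.1 x₀).eventually_of_infty 1,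
    (contDiffAt_coeff h.1.2 x₀).eventually_of_infty 1] with z hb hz hd1 hd2
  replace hd1 := hd1.differentiableAt (by simp)
  replace hd2 := hd2.differentiableAt (by simp)
  have hy : (chartAt ℂ x₀).symm z ∈ (chartAt ℂ x₀).source := (chartAt ℂ x₀).map_target hz
  rw [← dbar_coordVec hz hd1, ← dbar_coordVec hz hd2]
  rw [← (chartAt ℂ x₀).right_inv hz] at hd1 hd2
  set y := (chartAt ℂ x₀).symm z with hydef
  have hyb := mem_baseSet_trivializationAt ℂ S y
  obtain ⟨c1, d1, -⟩ := differentiableAt_chart_symm_of_chart hy hd1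
  obtain ⟨c2, d2, -⟩ := differentiableAt_chart_symm_of_chart hy hd2
  have hτ := mdifferentiableAt_coeff_frameAt (S := S) x₀ hb
  have hframe : frameAt S x₀ y = coeff (frameAt S x₀) y y • frameVec S y :=
    eq_coeff_smul_frameAt y hyb (frameAt S x₀)
  set τ := coeff (frameAt S x₀) y y with hτdef
  have hτ0 : τ ≠ 0 := by
    intro h0
    rw [h0, zero_smul] at hframe
    exact frameAt_ne_zero x₀ hb hframe
  -- The operator at `y` is written in the frame preferred at `y`. The holomorphic factor relating
  -- it to the frame at `x₀` passes through `∂̄`, which moves the equation to the fixed frame.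
  have ev1 := coeff_eventuallyEq x₀ hb ψ.1
  have ev2 := coeff_eventuallyEq x₀ hb (fun x => unbar (ψ.2 x))
  have hq0 := σ.sq_apply_ne_zero y (frameAt_ne_zero (S := S) y hyb) (baseVec_ne_zero y)
  have hc0 : tangentCoord y (coordVec x₀ z) ≠ 0 := coordVec_ne_zero x₀ hz
  obtain ⟨e1, e2⟩ := h.dbar_coeff y
  rw [dbar_congr ((hτ.continuousAt.smul c1).congr ev1.symm) ev1,
    dbar_holomorphic_smul hτ c1 d1, ev2.eq_of_nhds, smul_eq_mul, smul_eq_mul, ← neg_mul, ← neg_mul] at e1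
  rw [dbar_congr ((hτ.continuousAt.smul c2).congr ev2.symm) ev2,
    dbar_holomorphic_smul hτ c2 d2, ev1.eq_of_nhds, smul_eq_mul, smul_eq_mul] at e2
  have r1 := dirac_equation_rescale hτ0 hc0 hq0 e1
  have r2 := dirac_equation_rescale hτ0 hc0 hq0 e2
  have hcv : coordVec x₀ z = tangentCoord y (coordVec x₀ z) • baseVec y := tangent_eq_smul_baseVec y _
  have hqq : σ.frameSq x₀ z = τ ^ 2 * (tangentCoord y (coordVec x₀ z) *
      σ.sq y (frameAt S y y) (baseVec y)) := by
    rw [SpinStructure.frameSq, ← hydef, hframe, σ.sq_smul]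
    have : σ.sq y (frameVec S y) (coordVec x₀ z) =
        tangentCoord y (coordVec x₀ z) * σ.sq y (frameVec S y) (baseVec y) := by
      conv_lhs => rw [hcv, map_smul, smul_eq_mul]
    rw [_root_.smul_apply, this]
    rfl
  have hfac : g.factor x₀ z = ‖tangentCoord y (coordVec x₀ z)‖ ^ 2 * g.normSq y (baseVec y) := by
    rw [HermitianMetric.factor, g.normSq_eq]
  have hA : diracCoeff σ g lam x₀ z = (lam / 2 : ℂ) * (Real.sqrt
      (‖tangentCoord y (coordVec x₀ z)‖ ^ 2 * g.normSq y (baseVec y)) *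
      (starRingEnd ℂ) (τ ^ 2 * (tangentCoord y (coordVec x₀ z) *
      σ.sq y (frameAt S y y) (baseVec y))) / ‖τ ^ 2 * (tangentCoord y (coordVec x₀ z) *
      σ.sq y (frameAt S y y) (baseVec y))‖) := by
    rw [diracCoeff, hqq, hfac]
  rw [hA]
  constructor
  · conv_lhs => rw [hcv, dbar_smul c1, smul_eq_mul, r1]
    ring
  · conv_lhs => rw [hcv, dbar_smul c2, smul_eq_mul, r2]

end Frame

/-! ### The map to the projective line defined by an eigenspinor -/

theorem wbar_add {E : Type*} [NormedAddCommGroup E] [NormedSpace ℂ E] {f g : ℂ → E} {z : ℂ}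
    (hf : DifferentiableAt ℝ f z) (hg : DifferentiableAt ℝ g z) :
    wbar (fun w => f w + g w) z = wbar f z + wbar g z := by
  rw [HasFDerivAt.wbar_eq (f := fun w => f w + g w) (hf.hasFDerivAt.add hg.hasFDerivAt), wbar, wbar]
  simp
  module

theorem wbar_holomorphic_comp {E F : Type*} [NormedAddCommGroup E] [NormedSpace ℂ E]
    [NormedAddCommGroup F] [NormedSpace ℂ F] {H : E → F} {H' : E →L[ℂ] F} {f : ℂ → E} {z : ℂ}
    (hH : HasFDerivAt H H' (f z)) (hf : DifferentiableAt ℝ f z) :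
    wbar (fun w => H (f w)) z = H' (wbar f z) := by
  rw [HasFDerivAt.wbar_eq (f := fun w => H (f w)) ((hH.restrictScalars ℝ).comp z hf.hasFDerivAt),
    wbar]
  simp

theorem euclidean_pair_eq (a b : ℂ) :
    (!₂[a, b] : EuclideanSpace ℂ (Fin 2)) = a • !₂[1, 0] + b • !₂[0, 1] := by
  ext i
  fin_cases i <;> simp

theorem contDiffAt_pair {f h : ℂ → ℂ} {z : ℂ} {n : ℕ∞ω} (hf : ContDiffAt ℝ n f z)
    (hh : ContDiffAt ℝ n h z) :
    ContDiffAt ℝ n (fun w => (!₂[f w, h w] : EuclideanSpace ℂ (Fin 2))) z := by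
  simp_rw [euclidean_pair_eq (f _)]
  exact (hf.smul contDiffAt_const).add (hh.smul contDiffAt_const)

theorem wbar_pair {f h : ℂ → ℂ} {z : ℂ} (hf : DifferentiableAt ℝ f z)
    (hh : DifferentiableAt ℝ h z) :
    wbar (fun w => (!₂[f w, h w] : EuclideanSpace ℂ (Fin 2))) z = !₂[wbar f z, wbar h z] := by
  have h1 : ∀ (k : ℂ → ℂ) (e : EuclideanSpace ℂ (Fin 2)), DifferentiableAt ℝ k z →
      wbar (fun w => k w • e) z = wbar k z • e := fun k e hk =>
    wbar_holomorphic_comp (H := fun c : ℂ => c • e)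
      (ContinuousLinearMap.toSpanSingleton ℂ e).hasFDerivAt hk
  simp_rw [euclidean_pair_eq (f _)]
  rw [wbar_add (hf.smul_const _) (hh.smul_const _), h1 f _ hf, h1 h _ hh, ← euclidean_pair_eq]

/-- The quaternionic structure `(a, b) ↦ (-b̄, ā)` of `ℂ²`. -/
def quatJ : EuclideanSpace ℂ (Fin 2) →L[ℝ] EuclideanSpace ℂ (Fin 2) :=
  LinearMap.toContinuousLinearMap
    { toFun := fun u => !₂[-(starRingEnd ℂ) (u 1), (starRingEnd ℂ) (u 0)]
      map_add' := fun u v => by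
        ext i
        fin_cases i <;> simp [add_comm]
      map_smul' := fun c u => by
        ext i
        fin_cases i <;> simp }

theorem quatJ_apply (u : EuclideanSpace ℂ (Fin 2)) :
    quatJ u = !₂[-(starRingEnd ℂ) (u 1), (starRingEnd ℂ) (u 0)] := rfl

theorem norm_quatJ (u : EuclideanSpace ℂ (Fin 2)) : ‖quatJ u‖ = ‖u‖ := by
  rw [quatJ_apply, EuclideanSpace.norm_eq, EuclideanSpace.norm_eq]
  simp [Fin.sum_univ_two, add_comm]

/-- This cancellation makes `∂̄F` normal to the line of `F`, and so gives the energy density its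
exact value. -/
theorem inner_quatJ (u : EuclideanSpace ℂ (Fin 2)) : inner ℂ u (quatJ u) = 0 := by
  rw [quatJ_apply]
  simp [PiLp.inner_apply, Fin.sum_univ_two]
  ring

theorem mk_CP1_eq_of_smul {u v : EuclideanSpace ℂ (Fin 2)} (hu : u ≠ 0) (hv : v ≠ 0) {c : ℂ}
    (h : u = c • v) : (Projectivization.mk ℂ u hu : CP1) = Projectivization.mk ℂ v hv :=
  (Projectivization.mk_eq_mk_iff' ℂ u v hu hv).2 ⟨c, h.symm⟩

/-- The affine chart in homogeneous coordinates. -/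
theorem affineChart_mk (p : CP1) {v : EuclideanSpace ℂ (Fin 2)} (hv : v ≠ 0) :
    affineChart p (Projectivization.mk ℂ v hv) =
      (inner ℂ p.rep p.rep / inner ℂ p.rep v : ℂ) • v - p.rep := by
  obtain ⟨a, ha⟩ := Projectivization.exists_smul_eq_mk_rep ℂ v hv
  have ha' : (Projectivization.mk ℂ v hv).rep = (a : ℂ) • v := ha.symm
  rw [affineChart, ha', inner_smul_right, smul_smul]
  congr 2
  have := a.ne_zero
  rw [div_mul_eq_mul_div, mul_comm, mul_div_mul_left _ _ this]

/-- On vectors orthogonal to `p` the derivative of the denominator drops out. Only such vectors are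
needed, since `∂̄F` is a multiple of `J F`. -/
theorem hasFDerivAt_affineChart (p v : EuclideanSpace ℂ (Fin 2)) (hpv : inner ℂ p v ≠ 0) :
    ∃ H' : EuclideanSpace ℂ (Fin 2) →L[ℂ] EuclideanSpace ℂ (Fin 2),
      HasFDerivAt (𝕜 := ℂ) (fun w => (inner ℂ p p / inner ℂ p w : ℂ) • w - p) H' v ∧
      ∀ w, inner ℂ p w = 0 → H' w = (inner ℂ p p / inner ℂ p v : ℂ) • w := by
  have h1 : HasFDerivAt (𝕜 := ℂ) (fun w => (inner ℂ p w : ℂ)) (innerSL ℂ p) v :=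
    (innerSL ℂ p).hasFDerivAt
  have h2 := (((hasDerivAt_inv hpv).comp_hasFDerivAt v h1).const_mul (inner ℂ p p)).smul (hasFDerivAt_id (𝕜 := ℂ) v)
  refine ⟨_, (h2.sub_const p), fun w hw => ?_⟩
  simp [hw, div_eq_mul_inv]

theorem nhdsNE_neBot_of_chart {M : Type*} [TopologicalSpace M] [ChartedSpace ℂ M] (x : M) :
    (𝓝[≠] x).NeBot := by
  by_contra h
  rw [Filter.not_neBot, ← isOpen_singleton_iff_punctured_nhds] at h
  have h1 := (chartAt ℂ x).isOpen_image_of_subset_source h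
    (singleton_subset_iff.2 (mem_chart_source ℂ x))
  rw [image_singleton, isOpen_singleton_iff_punctured_nhds] at h1
  exact (inferInstance : (𝓝[≠] (chartAt ℂ x x)).NeBot).ne h1

section Frame

variable {M : Type*} [TopologicalSpace M] [ChartedSpace ℂ M]
  {S : M → Type*} [∀ x, AddCommGroup (S x)] [∀ x, Module ℂ (S x)] [∀ x, TopologicalSpace (S x)]
  [TopologicalSpace (TotalSpace ℂ S)] [FiberBundle ℂ S]

/-- The components of `(ψ₊, ψ̄₋)` in the local frame at `x₀`. -/
def spinorPair (ψ : SpinorField S) (x₀ y : M) : EuclideanSpace ℂ (Fin 2) :=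
  !₂[coeff ψ.1 x₀ y, coeff (fun x => unbar (ψ.2 x)) x₀ y]

variable [VectorBundle ℂ ℂ S]

theorem spinorPair_eq_smul (ψ : SpinorField S) {x₀ y : M}
    (hy : y ∈ (trivializationAt ℂ S x₀).baseSet) (s : S y) (hs : s ≠ 0) {a b : ℂ}
    (ha : ψ.1 y = a • s) (hb : unbar (ψ.2 y) = b • s) :
    ∃ c : ℂ, c ≠ 0 ∧ spinorPair ψ x₀ y = c • !₂[a, b] := by
  classical
  -- Coefficients are defined for sections, so the vector is extended by zero; only its value at `y`
  -- matters.
  let t : ∀ x, S x := Function.update 0 y s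
  have ht : t y = s := Function.update_self ..
  refine ⟨coeff t x₀ y, fun h0 => hs ?_, ?_⟩
  · rw [← ht, eq_coeff_smul_frameAt x₀ hy t, h0, zero_smul]
  · rw [spinorPair, coeff_smul x₀ hy ψ.1 t a (by rw [ha, ht]),
      coeff_smul x₀ hy (fun x => unbar (ψ.2 x)) t b (by rw [hb, ht])]
    ext i
    fin_cases i <;> simp [mul_comm]

theorem spinorPair_frame (ψ : SpinorField S) {x₀ x₁ y : M}
    (hy₀ : y ∈ (trivializationAt ℂ S x₀).baseSet) (hy₁ : y ∈ (trivializationAt ℂ S x₁).baseSet) :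
    ∃ c : ℂ, c ≠ 0 ∧ spinorPair ψ x₀ y = c • spinorPair ψ x₁ y :=
  spinorPair_eq_smul ψ hy₀ (frameAt S x₁ y) (frameAt_ne_zero x₁ hy₁)
    (eq_coeff_smul_frameAt x₁ hy₁ ψ.1) (eq_coeff_smul_frameAt x₁ hy₁ fun x => unbar (ψ.2 x))

theorem eq_zero_of_spinorPair_eq_zero (ψ : SpinorField S) {x₀ y : M}
    (hy : y ∈ (trivializationAt ℂ S x₀).baseSet) (h : spinorPair ψ x₀ y = 0) :
    ψ.1 y = 0 ∧ ψ.2 y = 0 := by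
  have h0 : coeff ψ.1 x₀ y = 0 := congrArg (fun u : EuclideanSpace ℂ (Fin 2) => u 0) h
  have h1 : coeff (fun x => unbar (ψ.2 x)) x₀ y = 0 :=
    congrArg (fun u : EuclideanSpace ℂ (Fin 2) => u 1) h
  refine ⟨by rw [eq_coeff_smul_frameAt x₀ hy ψ.1, h0, zero_smul], ?_⟩
  have := eq_coeff_smul_frameAt x₀ hy (fun x => unbar (ψ.2 x))
  rw [h1, zero_smul] at this
  exact this

theorem IsSpinorMap.apply_eq {ψ : SpinorField S} {Ψ : M → CP1} (h : IsSpinorMap ψ Ψ) {x₀ y : M}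
    (hy : y ∈ (trivializationAt ℂ S x₀).baseSet) (h0 : spinorPair ψ x₀ y ≠ 0) :
    Ψ y = Projectivization.mk ℂ (spinorPair ψ x₀ y) h0 :=
  h.2 y (frameAt S x₀ y) _ _ h0 (frameAt_ne_zero x₀ hy) (eq_coeff_smul_frameAt x₀ hy ψ.1)
    (eq_coeff_smul_frameAt x₀ hy fun x => unbar (ψ.2 x))

variable [IsManifold 𝓘(ℂ, ℂ) ω M] [ContMDiffVectorBundle ω ℂ S 𝓘(ℂ, ℂ)]

theorem contDiffAt_spinorPair {ψ : SpinorField S} (h : IsSmoothSpinor ψ) (x₀ : M) :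
    ContDiffAt ℝ ∞ (fun z => spinorPair ψ x₀ ((chartAt ℂ x₀).symm z)) (chartAt ℂ x₀ x₀) :=
  contDiffAt_pair (contDiffAt_coeff h.1 x₀) (contDiffAt_coeff h.2 x₀)

theorem eventually_comp_chart {x : M} {p : ℂ → Prop} (h : ∀ᶠ z in 𝓝 (chartAt ℂ x x), p z) :
    ∀ᶠ y in 𝓝 x, p (chartAt ℂ x y) :=
  ((chartAt ℂ x).continuousAt (mem_chart_source ℂ x)).eventually h

theorem continuousAt_spinorPair {ψ : SpinorField S} (h : IsSmoothSpinor ψ) (x₀ : M) :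
    ContinuousAt (spinorPair ψ x₀) x₀ := by
  have h1 := (differentiableAt_chart_symm_of_chart (F := spinorPair ψ x₀) (mem_chart_source ℂ x₀)
    ((contDiffAt_spinorPair h x₀).differentiableAt (by simp))).1
  exact h1

theorem IsEigenspinor.wbar_spinorPair {σ : SpinStructure S} {g : HermitianMetric M} {lam : ℝ}
    {ψ : SpinorField S} (h : IsEigenspinor σ g lam ψ) (x₀ : M) :
    ∀ᶠ z in 𝓝 (chartAt ℂ x₀ x₀),
      wbar (fun z => spinorPair ψ x₀ ((chartAt ℂ x₀).symm z)) z =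
        diracCoeff σ g lam x₀ z • quatJ (spinorPair ψ x₀ ((chartAt ℂ x₀).symm z)) := by
  filter_upwards [h.wbar_coeff x₀, (contDiffAt_coeff h.1.1 x₀).eventually_of_infty 1,
    (contDiffAt_coeff h.1.2 x₀).eventually_of_infty 1] with z hz hd1 hd2
  have := wbar_pair (hd1.differentiableAt (by simp)) (hd2.differentiableAt (by simp))
  rw [hz.1, hz.2] at this
  refine this.trans ?_
  rw [quatJ_apply]
  ext i
  fin_cases i <;> simp [spinorPair]

theorem IsEigenspinor.dichotomy {σ : SpinStructure S} {g : HermitianMetric M} {lam : ℝ}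
    {ψ : SpinorField S} (h : IsEigenspinor σ g lam ψ) (x₀ : M) :
    (∀ᶠ y in 𝓝 x₀, spinorPair ψ x₀ y = 0) ∨
    ∃ W : M → EuclideanSpace ℂ (Fin 2), ContinuousAt W x₀ ∧ W x₀ ≠ 0 ∧
      ∀ᶠ y in 𝓝 x₀, y ≠ x₀ → ∃ c : ℂ, c ≠ 0 ∧ spinorPair ψ x₀ y = c • W y := by
  rcases eventually_eq_zero_or_exists_pow_smul (contDiffAt_spinorPair h.1 x₀)
    (contDiffAt_diracCoeff σ g lam x₀) quatJ (h.wbar_spinorPair x₀) with h1 | ⟨k, w, hw, hw0, hU⟩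
  · left
    filter_upwards [eventually_comp_chart h1,
      (chartAt ℂ x₀).open_source.mem_nhds (mem_chart_source ℂ x₀)] with y hy hy2
    rwa [(chartAt ℂ x₀).left_inv hy2] at hy
  · right
    refine ⟨fun y => w (chartAt ℂ x₀ y), hw.comp ((chartAt ℂ x₀).continuousAt
      (mem_chart_source ℂ x₀)), hw0, ?_⟩
    filter_upwards [(chartAt ℂ x₀).open_source.mem_nhds (mem_chart_source ℂ x₀)] with y hy hyx
    have hne : chartAt ℂ x₀ y ≠ chartAt ℂ x₀ x₀ := fun he =>
      hyx ((chartAt ℂ x₀).injOn hy (mem_chart_source ℂ x₀) he)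
    refine ⟨_, pow_ne_zero k (sub_ne_zero.2 hne), ?_⟩
    have := hU _ hne
    rwa [(chartAt ℂ x₀).left_inv hy] at this

/-- An eigenspinor on a connected surface has, near every point, a continuous nonvanishing
representative of the point `[ψ₊ : ψ̄₋]`. -/
theorem IsEigenspinor.exists_reduced_lift [ConnectedSpace M] {σ : SpinStructure S}
    {g : HermitianMetric M} {lam : ℝ} {ψ : SpinorField S} (h : IsEigenspinor σ g lam ψ) (x₀ : M) :
    ∃ W : M → EuclideanSpace ℂ (Fin 2), ContinuousAt W x₀ ∧ W x₀ ≠ 0 ∧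
      ∀ᶠ y in 𝓝 x₀, y ≠ x₀ → ∃ c : ℂ, c ≠ 0 ∧ spinorPair ψ x₀ y = c • W y := by
  have hbase : ∀ x : M, ∀ᶠ y in 𝓝 x, y ∈ (trivializationAt ℂ S x).baseSet := fun x =>
    (trivializationAt ℂ S x).open_baseSet.mem_nhds (mem_baseSet_trivializationAt ℂ S x)
  -- The interior of the zero set is open. It is also closed, because at a point outside it the
  -- zeros are isolated; connectedness leaves `∅` or `M`, and `M` contradicts `ψ ≠ 0`.
  let Z : Set M := {x | ∀ᶠ y in 𝓝 x, ψ.1 y = 0 ∧ ψ.2 y = 0}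
  have hZo : IsOpen Z := isOpen_iff_mem_nhds.2 fun x hx => eventually_eventually_nhds.2 hx
  have hzero : ∀ x, (∀ᶠ y in 𝓝 x, spinorPair ψ x y = 0) → x ∈ Z := by
    intro x hx
    filter_upwards [hx, hbase x] with y hy hb
    exact eq_zero_of_spinorPair_eq_zero ψ hb hy
  have hpair : ∀ x y, y ∈ (trivializationAt ℂ S x).baseSet → ψ.1 y = 0 ∧ ψ.2 y = 0 →
      spinorPair ψ x y = 0 := by
    intro x y hy h0
    obtain ⟨c, -, hc⟩ := spinorPair_eq_smul ψ hy (frameAt S x y) (frameAt_ne_zero x hy) (a := 0)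
      (b := 0) (by rw [h0.1, zero_smul]) (by rw [h0.2, zero_smul]; rfl)
    rw [hc]
    ext i
    fin_cases i <;> simp
  have hZc : IsClosed Z := by
    rw [← isOpen_compl_iff, isOpen_iff_mem_nhds]
    intro x hx
    rcases h.dichotomy x with h1 | ⟨W, hW, hW0, hWe⟩
    · exact absurd (hzero x h1) hx
    · filter_upwards [hWe, hbase x, hW.eventually_ne hW0] with y hy hb hWy hyZ
      rcases eq_or_ne y x with rfl | hyx
      · exact hx hyZ
      · obtain ⟨c, hc, he⟩ := hy hyx
        have h0 : ψ.1 y = 0 ∧ ψ.2 y = 0 :=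
          (show ∀ᶠ w in 𝓝 y, ψ.1 w = 0 ∧ ψ.2 w = 0 from hyZ).self_of_nhds
        rw [hpair x y hb h0] at he
        exact (smul_ne_zero hc hWy) he.symm
  rcases isClopen_iff.1 ⟨hZc, hZo⟩ with h1 | h1
  · rcases h.dichotomy x₀ with h2 | h2
    · have := hzero x₀ h2
      rw [h1] at this
      exact this.elim
    · exact h2
  · refine absurd ?_ h.2.1
    have h2 : ∀ x, ψ.1 x = 0 ∧ ψ.2 x = 0 := fun x =>
      (show ∀ᶠ w in 𝓝 x, ψ.1 w = 0 ∧ ψ.2 w = 0 from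
        (show x ∈ Z by rw [h1]; trivial)).self_of_nhds
    exact Prod.ext (funext fun x => (h2 x).1) (funext fun x => (h2 x).2)

theorem IsEigenspinor.eventually_spinorPair_ne_zero [ConnectedSpace M] {σ : SpinStructure S}
    {g : HermitianMetric M} {lam : ℝ} {ψ : SpinorField S} (h : IsEigenspinor σ g lam ψ) (x₀ : M) :
    ∀ᶠ y in 𝓝[≠] x₀, spinorPair ψ y y ≠ 0 := by
  obtain ⟨W, hW, hW0, hWe⟩ := h.exists_reduced_lift x₀
  filter_upwards [nhdsWithin_le_nhds hWe, nhdsWithin_le_nhds (hW.eventually_ne hW0),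
    nhdsWithin_le_nhds ((trivializationAt ℂ S x₀).open_baseSet.mem_nhds
      (mem_baseSet_trivializationAt ℂ S x₀)), self_mem_nhdsWithin] with y hy hWy hb hyx h0
  obtain ⟨c, hc, he⟩ := hy hyx
  obtain ⟨d, -, hd⟩ := spinorPair_frame ψ hb (mem_baseSet_trivializationAt ℂ S y)
  rw [h0, smul_zero, he] at hd
  exact smul_ne_zero hc hWy hd

theorem IsEigenspinor.exists_isSpinorMap [ConnectedSpace M] {σ : SpinStructure S}
    {g : HermitianMetric M} {lam : ℝ} {ψ : SpinorField S} (h : IsEigenspinor σ g lam ψ) :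
    ∃ Ψ : M → CP1, IsSpinorMap ψ Ψ := by
  classical
  have hlift : ∀ x₀, ∃ W : M → EuclideanSpace ℂ (Fin 2), ContinuousAt W x₀ ∧ W x₀ ≠ 0 ∧
      (spinorPair ψ x₀ x₀ ≠ 0 → W x₀ = spinorPair ψ x₀ x₀) ∧
      ∀ᶠ y in 𝓝 x₀, y ≠ x₀ → ∃ c : ℂ, c ≠ 0 ∧ spinorPair ψ x₀ y = c • W y := by
    intro x₀
    -- A reduced lift is tied to `ψ` only off `x₀`. Where `ψ x₀ ≠ 0` the pair itself is chosen, so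
    -- that the map has the prescribed value at `x₀`.
    by_cases h0 : spinorPair ψ x₀ x₀ = 0
    · obtain ⟨W, h1, h2, h3⟩ := h.exists_reduced_lift x₀
      exact ⟨W, h1, h2, fun h4 => absurd h0 h4, h3⟩
    · exact ⟨spinorPair ψ x₀, continuousAt_spinorPair h.1 x₀, h0, fun _ => rfl,
        Filter.Eventually.of_forall fun y _ => ⟨1, one_ne_zero, (one_smul ℂ _).symm⟩⟩
  choose W hWc hW0 hWp hWe using hlift
  let Ψ : M → CP1 := fun x => Projectivization.mk ℂ (W x x) (hW0 x)
  have hΨ : ∀ y (h0 : spinorPair ψ y y ≠ 0), Ψ y = Projectivization.mk ℂ (spinorPair ψ y y) h0 :=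
    fun y h0 => mk_CP1_eq_of_smul (c := 1) _ _ (by rw [one_smul, hWp y h0])
  refine ⟨Ψ, continuous_iff_continuousAt.2 fun x₀ => ?_, ?_⟩
  · refine continuousAt_mk_CP1 (hWc x₀) (hW0 x₀) ?_
    filter_upwards [hWe x₀, (trivializationAt ℂ S x₀).open_baseSet.mem_nhds
      (mem_baseSet_trivializationAt ℂ S x₀)] with y hy hb hWy
    rcases eq_or_ne y x₀ with rfl | hyx
    · rfl
    · obtain ⟨c, hc, he⟩ := hy hyx
      obtain ⟨d, hd, hde⟩ := spinorPair_frame ψ (mem_baseSet_trivializationAt ℂ S y) hb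
      have h1 : spinorPair ψ y y = (d * c) • W x₀ y := by rw [hde, he, smul_smul]
      have h0 : spinorPair ψ y y ≠ 0 := by
        rw [h1]
        exact smul_ne_zero (mul_ne_zero hd hc) hWy
      rw [hΨ y h0]
      exact mk_CP1_eq_of_smul _ _ h1
  · intro x s a b hab hs ha hb
    obtain ⟨c, hc, he⟩ := spinorPair_eq_smul ψ (mem_baseSet_trivializationAt ℂ S x) s hs ha hb
    have h0 : spinorPair ψ x x ≠ 0 := by
      rw [he]
      exact smul_ne_zero hc hab
    rw [hΨ x h0]
    exact mk_CP1_eq_of_smul _ _ he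

/-- Zeros are isolated and the surface has no isolated points, so the maps agree on a dense set; the
target is Hausdorff. -/
theorem IsEigenspinor.isSpinorMap_unique [ConnectedSpace M] {σ : SpinStructure S}
    {g : HermitianMetric M} {lam : ℝ} {ψ : SpinorField S} (h : IsEigenspinor σ g lam ψ)
    {Ψ Ψ' : M → CP1} (hΨ : IsSpinorMap ψ Ψ) (hΨ' : IsSpinorMap ψ Ψ') : Ψ = Ψ' := by
  have hne : ∀ x : M, (𝓝[≠] x).NeBot := nhdsNE_neBot_of_chart
  have hd : Dense {y : M | spinorPair ψ y y ≠ 0} := fun x =>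
    mem_closure_iff_frequently.2
      (((h.eventually_spinorPair_ne_zero x).frequently).filter_mono nhdsWithin_le_nhds)
  refine hΨ.1.ext_on hd hΨ'.1 fun y hy => ?_
  rw [hΨ.apply_eq (mem_baseSet_trivializationAt ℂ S y) hy,
    hΨ'.apply_eq (mem_baseSet_trivializationAt ℂ S y) hy]

theorem IsEigenspinor.finite_zeros [ConnectedSpace M] [CompactSpace M] {σ : SpinStructure S}
    {g : HermitianMetric M} {lam : ℝ} {ψ : SpinorField S} (h : IsEigenspinor σ g lam ψ) :
    {y : M | spinorPair ψ y y = 0}.Finite := by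
  by_contra hinf
  obtain ⟨x, -, hx⟩ := Set.Infinite.exists_accPt_of_subset_isCompact hinf isCompact_univ
    (subset_univ _)
  rw [accPt_iff_frequently_nhdsNE] at hx
  exact hx (h.eventually_spinorPair_ne_zero x)

/-- Off the zeros of the eigenspinor, `|∂̄Ψ|² dv_{g'} = λ² dv_g`. -/
theorem IsEigenspinor.dbarNormSq_eq {σ : SpinStructure S} {g : HermitianMetric M} {lam : ℝ}
    {ψ : SpinorField S} (h : IsEigenspinor σ g lam ψ) {Ψ : M → CP1} (hΨ : IsSpinorMap ψ Ψ)
    (g' : HermitianMetric M) {y : M} (hy : spinorPair ψ y y ≠ 0) :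
    dbarNormSq g' Ψ y = lam ^ 2 * g.ratio g' y := by
  have hyb := mem_baseSet_trivializationAt ℂ S y
  have hc := continuousAt_spinorPair h.1 y
  set p := (Ψ y).rep with hp
  set F₀ := spinorPair ψ y y with hF₀
  obtain ⟨c, hcp⟩ : ∃ c : ℂˣ, (c : ℂ) • F₀ = p := by
    obtain ⟨c, hc⟩ := Projectivization.exists_smul_eq_mk_rep ℂ F₀ hy
    exact ⟨c, by rw [hp, hΨ.apply_eq hyb hy]; exact hc⟩
  have hFF : inner ℂ F₀ F₀ ≠ (0 : ℂ) := inner_self_ne_zero.2 hy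
  have hpF : inner ℂ p F₀ ≠ (0 : ℂ) := by
    rw [← hcp, inner_smul_left]
    exact mul_ne_zero (by simp) hFF
  -- With `p = c F₀`, the derivative of the affine chart multiplies normal vectors by `c`; this
  -- factor cancels against `‖p‖² = |c|² ‖F₀‖²` in the norm.
  have hquot : (inner ℂ p p / inner ℂ p F₀ : ℂ) = c := by
    rw [div_eq_iff hpF]
    nth_rewrite 2 [← hcp]
    rw [inner_smul_right]
  obtain ⟨H', hH, hH'⟩ := hasFDerivAt_affineChart p F₀ hpF
  have hev : (fun w => (inner ℂ p p / inner ℂ p (spinorPair ψ y w) : ℂ) • spinorPair ψ y w - p)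
      =ᶠ[𝓝 y] fun w => affineChart (Ψ y) (Ψ w) := by
    filter_upwards [hc.eventually_ne hy, (trivializationAt ℂ S y).open_baseSet.mem_nhds hyb]
      with w hw hwb
    rw [hΨ.apply_eq hwb hw, affineChart_mk]
  have hHc : ContinuousAt (fun w =>
      (inner ℂ p p / inner ℂ p (spinorPair ψ y w) : ℂ) • spinorPair ψ y w - p) y :=
    ContinuousAt.comp (f := spinorPair ψ y) (x := y) hH.continuousAt hc
  have hyy := (chartAt ℂ y).left_inv (mem_chart_source ℂ y)
  have hdF : DifferentiableAt ℝ (fun z => spinorPair ψ y ((chartAt ℂ y).symm z)) (chartAt ℂ y y) :=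
    (contDiffAt_spinorPair h.1 y).differentiableAt (by simp)
  set q := σ.sq y (frameVec S y) (baseVec y) with hqdef
  have hq : q ≠ 0 := σ.sq_apply_ne_zero y (frameAt_ne_zero (S := S) y hyb) (baseVec_ne_zero y)
  set A : ℂ := (lam / 2 : ℂ) * (Real.sqrt (g.normSq y (baseVec y)) * (starRingEnd ℂ) q / ‖q‖)
    with hA
  have hwF : wbar (fun z => spinorPair ψ y ((chartAt ℂ y).symm z)) (chartAt ℂ y y) =
      A • quatJ F₀ := by
    have hd1 := (contDiffAt_coeff h.1.1 y).differentiableAt (by simp)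
    have hd2 := (contDiffAt_coeff h.1.2 y).differentiableAt (by simp)
    have c1 := (differentiableAt_chart_symm_of_chart (F := coeff ψ.1 y) (mem_chart_source ℂ y)
      hd1).1
    have c2 := (differentiableAt_chart_symm_of_chart (F := coeff (fun x => unbar (ψ.2 x)) y)
      (mem_chart_source ℂ y) hd2).1
    obtain ⟨e1, e2⟩ := h.dbar_coeff y
    rw [dbar_baseVec c1] at e1
    rw [dbar_baseVec c2] at e2
    refine (wbar_pair hd1 hd2).trans ?_
    rw [e1, e2, quatJ_apply]
    ext i
    fin_cases i <;> simp [spinorPair, hF₀, hA, hqdef]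
  have hJ : inner ℂ p (A • quatJ F₀) = (0 : ℂ) := by
    rw [← hcp, inner_smul_left, inner_smul_right, inner_quatJ, mul_zero, mul_zero]
  have hmap : dbarMap Ψ y (baseVec y) = (c : ℂ) • A • quatJ F₀ := by
    rw [dbarMap, ← dbar_congr hHc hev, dbar_baseVec hHc]
    have hH2 : HasFDerivAt (𝕜 := ℂ) (fun w => (inner ℂ p p / inner ℂ p w : ℂ) • w - p) H'
        (spinorPair ψ y ((chartAt ℂ y).symm (chartAt ℂ y y))) := by rwa [hyy]
    rw [wbar_holomorphic_comp hH2 hdF, hwF, hH' _ hJ, hquot]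
  -- The `1/4` comes from the factor `2` in the Dirac operator and cancels the `4` in the metric of
  -- the unit sphere.
  have hAn : ‖A‖ ^ 2 = lam ^ 2 / 4 * g.normSq y (baseVec y) := by
    have hqn : ‖q‖ ≠ 0 := by simpa using hq
    rw [hA]
    simp only [norm_mul, norm_div, Complex.norm_real, RCLike.norm_conj, norm_norm,
      Real.norm_of_nonneg (Real.sqrt_nonneg _), Complex.norm_ofNat]
    rw [mul_div_cancel_right₀ _ hqn, mul_pow, Real.sq_sqrt (g.normSq_baseVec_pos y).le, div_pow,
      Real.norm_eq_abs, sq_abs]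
    norm_num
  have hcn : ‖(c : ℂ)‖ ≠ 0 := by simp
  have hFn : ‖F₀‖ ≠ 0 := by simpa using hy
  have hG' := (g'.normSq_baseVec_pos y).ne'
  rw [dbarNormSq, hmap, ← hp, ← hcp, norm_smul, norm_smul, norm_smul, norm_quatJ, mul_pow, mul_pow,
    mul_pow, hAn, HermitianMetric.ratio]
  field_simp

theorem IsEigenspinor.energy01_eq [T2Space M] [ConnectedSpace M] [CompactSpace M]
    [MeasurableSpace M] [BorelSpace M] {σ : SpinStructure S} {g : HermitianMetric M} {lam : ℝ}
    {ψ : SpinorField S} (h : IsEigenspinor σ g lam ψ) {Ψ : M → CP1} (hΨ : IsSpinorMap ψ Ψ)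
    (g' : HermitianMetric M) : energy01 g' Ψ = ENNReal.ofReal (lam ^ 2) * g.area := by
  have hae : ∀ᵐ y ∂g'.areaMeasure, ENNReal.ofReal (dbarNormSq g' Ψ y) =
      ENNReal.ofReal (lam ^ 2) * ENNReal.ofReal (g.ratio g' y) := by
    refine ae_iff.2 (measure_mono_null (fun y hy => ?_) (g'.areaMeasure_finite h.finite_zeros))
    by_contra h0
    exact hy (by rw [h.dbarNormSq_eq hΨ g' h0, ENNReal.ofReal_mul (sq_nonneg lam)])
  rw [energy01, lintegral_congr_ae hae, lintegral_const_mul' _ _ ENNReal.ofReal_ne_top,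
    HermitianMetric.area, g.areaMeasure_eq_withDensity g', withDensity_apply _ MeasurableSet.univ,
    Measure.restrict_univ]

/-! ### Symmetry of the spectrum and comparison of the infima -/

theorem coeff_neg_eventuallyEq (s : ∀ x, S x) (x : M) :
    coeff (fun y => -s y) x =ᶠ[𝓝 x] fun y => (-1 : ℂ) • coeff s x y := by
  filter_upwards [(trivializationAt ℂ S x).open_baseSet.mem_nhds
    (mem_baseSet_trivializationAt ℂ S x)] with y hy
  rw [coeff_smul x hy (fun y => -s y) s (-1) (by rw [neg_one_smul]), smul_eq_mul]

theorem IsSmoothSection.neg {s : ∀ x, S x} (hs : IsSmoothSection s) :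
    IsSmoothSection fun x => -s x := by
  intro x
  have h := (Bundle.contMDiffAt_section x).1 (hs x)
  refine (Bundle.contMDiffAt_section x).2 (ContMDiffAt.congr_of_eventuallyEq ?_
    (coeff_neg_eventuallyEq s x))
  have h2 : ContDiff ℝ ∞ fun c : ℂ => (-1 : ℂ) • c := contDiff_const_smul _
  exact h2.contMDiff.contMDiffAt.comp x h

theorem dbarOp_neg (σ : SpinStructure S) (g : HermitianMetric M) {s : ∀ x, S x}
    (hs : IsSmoothSection s) : dbarOp σ g (fun x => -s x) = -dbarOp σ g s := by
  funext x
  have hd := (contDiffAt_coeff hs x).differentiableAt (by simp)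
  obtain ⟨h1, h2, -⟩ := differentiableAt_chart_symm_of_chart (F := coeff s x)
    (mem_chart_source ℂ x) hd
  have h3 : dbar (coeff (fun y => -s y) x) x (baseVec x) = -dbar (coeff s x) x (baseVec x) := by
    have h4 := coeff_neg_eventuallyEq s x
    rw [dbar_congr ((h1.const_smul (-1 : ℂ)).congr h4.symm) h4,
      dbar_holomorphic_smul (φ := fun _ => (-1 : ℂ)) mdifferentiableAt_const h1 h2, neg_one_smul]
  rw [Pi.neg_apply, dbarOp, dbarOp, h3, ← neg_smul, neg_div, mul_neg]

/-- The conjugate eigenspinor `(ψ₊, -ψ₋)` has the opposite eigenvalue. -/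
theorem IsEigenspinor.neg {σ : SpinStructure S} {g : HermitianMetric M} {lam : ℝ}
    {ψ : SpinorField S} (h : IsEigenspinor σ g lam ψ) :
    IsEigenspinor σ g (-lam) (ψ.1, -ψ.2) := by
  refine ⟨⟨h.1.1, h.1.2.neg⟩, fun h0 => h.2.1 ?_, ?_⟩
  · have h1 : ψ.1 = 0 := congrArg Prod.fst h0
    have h2 : -ψ.2 = 0 := congrArg Prod.snd h0
    exact Prod.ext h1 (neg_eq_zero.1 h2)
  · have h1 := congrArg Prod.fst h.2.2
    have h2 := congrArg Prod.snd h.2.2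
    have e1 : (2 : ℂ) • delOp σ g ψ.2 = (lam : ℂ) • ψ.1 := h1
    have e2 : (2 : ℂ) • -dbarOp σ g ψ.1 = (lam : ℂ) • ψ.2 := h2
    have h3 : delOp σ g (-ψ.2) = -delOp σ g ψ.2 := dbarOp_neg σ g h.1.2
    refine Prod.ext ?_ ?_
    · change (2 : ℂ) • delOp σ g (-ψ.2) = ((-lam : ℝ) : ℂ) • ψ.1
      rw [h3, smul_neg, e1, Complex.ofReal_neg, neg_smul]
    · change (2 : ℂ) • -dbarOp σ g ψ.1 = ((-lam : ℝ) : ℂ) • -ψ.2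
      rw [e2, Complex.ofReal_neg, neg_smul, smul_neg, neg_neg]

/-- Only positive eigenvalues enter `lambdaOne`, while `eigenspinorMaps` allows both signs; the
symmetry `λ ↦ -λ` bridges the two. -/
theorem lambdaOne_le {σ : SpinStructure S} {g : HermitianMetric M} {lam : ℝ}
    {ψ : SpinorField S} (h : IsEigenspinor σ g lam ψ) (hlam : lam ≠ 0) :
    lambdaOne σ g ≤ ENNReal.ofReal |lam| := by
  rcases lt_or_gt_of_ne hlam with h0 | h0
  · rw [abs_of_neg h0]
    exact iInf₂_le (-lam) ⟨by linarith, _, h.neg⟩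
  · rw [abs_of_pos h0]
    exact iInf₂_le lam ⟨h0, ψ, h⟩

theorem sq_mul_rpow_half {a b : ℝ≥0∞} : (a * b ^ (1 / 2 : ℝ)) ^ 2 = a ^ 2 * b := by
  rw [mul_pow, ← ENNReal.rpow_natCast (b ^ (1 / 2 : ℝ)), ← ENNReal.rpow_mul]
  norm_num

theorem LambdaOne_sq_eq [T2Space M] [ConnectedSpace M] [CompactSpace M]
    [MeasurableSpace M] [BorelSpace M] (σ : SpinStructure S) (g' : HermitianMetric M) :
    LambdaOne σ ^ 2 = ⨅ Ψ ∈ eigenspinorMaps σ, energy01 g' Ψ := by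
  apply le_antisymm
  · refine le_iInf₂ fun Ψ ⟨g, lam, ψ, hlam, hψ, hΨ⟩ => ?_
    rw [hψ.energy01_eq hΨ g']
    have h1 : LambdaOne σ ≤ ENNReal.ofReal |lam| * g.area ^ (1 / 2 : ℝ) :=
      (iInf_le _ g).trans (mul_le_mul_left (lambdaOne_le hψ hlam) _)
    refine (pow_le_pow_left' h1 2).trans_eq ?_
    rw [sq_mul_rpow_half, ← ENNReal.ofReal_pow (abs_nonneg lam), sq_abs]
  · set m := ⨅ Ψ ∈ eigenspinorMaps σ, energy01 g' Ψ with hm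
    have h1 : m ^ (1 / 2 : ℝ) ≤ LambdaOne σ := by
      refine le_iInf fun g => ?_
      -- An area in `(0, ∞)` allows the factor to be moved across the infimum over eigenvalues, even
      -- when that infimum is `⊤`.
      have hA0 : g.area ^ (1 / 2 : ℝ) ≠ 0 := by
        simp [ENNReal.rpow_eq_zero_iff, g.area_ne_zero]
      have hAt : g.area ^ (1 / 2 : ℝ) ≠ ⊤ :=
        ENNReal.rpow_ne_top_of_nonneg (by norm_num) g.area_lt_top.ne
      rw [← ENNReal.div_le_iff hA0 hAt]
      refine le_iInf₂ fun lam ⟨hlam, ψ, hψ⟩ => ?_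
      rw [ENNReal.div_le_iff hA0 hAt]
      obtain ⟨Ψ, hΨ⟩ := hψ.exists_isSpinorMap
      have h2 : m ≤ ENNReal.ofReal (lam ^ 2) * g.area :=
        (iInf₂_le Ψ ⟨g, lam, ψ, hlam.ne', hψ, hΨ⟩).trans_eq (hψ.energy01_eq hΨ g')
      rw [ENNReal.ofReal_pow hlam.le, ← sq_mul_rpow_half] at h2
      have h3 := ENNReal.rpow_le_rpow h2 (by norm_num : (0 : ℝ) ≤ 1 / 2)
      rwa [← ENNReal.rpow_natCast (ENNReal.ofReal lam * g.area ^ (1 / 2 : ℝ)), ← ENNReal.rpow_mul,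
        show ((2 : ℕ) : ℝ) * (1 / 2) = 1 by norm_num, ENNReal.rpow_one] at h3
    have h4 := pow_le_pow_left' h1 2
    have h5 := sq_mul_rpow_half (a := 1) (b := m)
    simp only [one_mul, one_pow] at h5
    rwa [h5] at h4

end Frame

end DiracSurface

end

theorem lemma3 {M : Type*} [TopologicalSpace M] [T2Space M] [CompactSpace M] [ConnectedSpace M]
    [ChartedSpace ℂ M] [IsManifold 𝓘(ℂ, ℂ) ω M] [MeasurableSpace M] [BorelSpace M]
    {S : M → Type*} [∀ x, AddCommGroup (S x)] [∀ x, Module ℂ (S x)]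
    [∀ x, TopologicalSpace (S x)] [TopologicalSpace (TotalSpace ℂ S)] [FiberBundle ℂ S]
    [VectorBundle ℂ ℂ S] [ContMDiffVectorBundle ω ℂ S 𝓘(ℂ, ℂ)]
    (σ : DiracSurface.SpinStructure S) :
    (∀ (g : DiracSurface.HermitianMetric M) (lam : ℝ) (ψ : DiracSurface.SpinorField S),
      lam ≠ 0 → DiracSurface.IsEigenspinor σ g lam ψ →
        (∃! Ψ : M → DiracSurface.CP1, DiracSurface.IsSpinorMap ψ Ψ) ∧
        ∀ Ψ : M → DiracSurface.CP1, DiracSurface.IsSpinorMap ψ Ψ →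
          Ψ ∈ DiracSurface.eigenspinorMaps σ ∧
          ∀ g' : DiracSurface.HermitianMetric M,
            DiracSurface.energy01 g' Ψ = ENNReal.ofReal (lam ^ 2) * g.area) ∧
    ∀ g' : DiracSurface.HermitianMetric M,
      DiracSurface.LambdaOne σ ^ 2 =
        ⨅ Ψ ∈ DiracSurface.eigenspinorMaps σ, DiracSurface.energy01 g' Ψ := by
  refine ⟨fun g lam ψ hlam hψ => ?_, DiracSurface.LambdaOne_sq_eq σ⟩
  obtain ⟨Ψ₀, hΨ₀⟩ := hψ.exists_isSpinorMap
  exact ⟨⟨Ψ₀, hΨ₀, fun Ψ hΨ => hψ.isSpinorMap_unique hΨ hΨ₀⟩, fun Ψ hΨ =>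
    ⟨⟨g, lam, ψ, hlam, hψ, hΨ⟩, hψ.energy01_eq hΨ⟩⟩
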